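/- Let $(W,S)$ be a right-angled Coxeter system of finite rank (all entries of its Coxeter matrix are $1$, $2$ or $\infty$), with length function $l$. Call $w\in W$ \emph{firm} if there is exactly one $r\in S$ with $l(wr)<l(w)$; equivalently, all reduced words representing $w$ end in the same letter. Let $\Delta$ be a building of type $(W,S)$, regarded as a chamber system, with Weyl distance $\delta$, and assume that $\Delta$ is thick (every panel contains at least three chambers) and semi-regular (for each $s\in S$, all $s$-panels have the same cardinality). Write $d_W(c,d)=l(\delta(c,d))$ for the gallery distance and $\mathsf{B}(c_0,n)=\{c : d_W(c_0,c)\le n\}$. Let $\mathrm{Aut}(\Delta)$ be the group of type-preserving automorphisms of $\Delta$. Fix a chamber $c_0$ and $n\in\mathbb{N}=\{0,1,2,\dots\}$. A chamber $c$ with $k:=d_W(c_0,c)>n$ is called \emph{$n$-flexible with respect to $c_0$} if for each minimal gallery $(c_0,c_1,\dots,c_k=c)$ from $c_0$ to $c$, none of the elements $\delta(c_0,c_{n+1}),\dots,\delta(c_0,c_k)$ of $W$ is firm; all chambers of $\mathsf{B}(c_0,n)$ are also called $n$-flexible. Let $\mathrm{Flex}(c_0,n)$ be the set of all chambers that are $n$-flexible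 with respect to $c_0$. Let $K=\mathrm{Fix}_{\mathrm{Aut}(\Delta)}(\mathsf{B}(c_0,n))$ be the pointwise stabilizer of $\mathsf{B}(c_0,n)$ in $\mathrm{Aut}(\Delta)$. Then the set of chambers fixed by all elements of $K$ is equal to $\mathrm{Flex}(c_0,n)$, and $\mathrm{Flex}(c_0,n)$ is bounded, i.e. it has finite diameter for $d_W$. -/

import Mathlib

/-- A Coxeter matrix is right-angled if all its entries are `1`, `2` or `∞`
(Mathlib encodes the entry `∞` as `0`). -/
def CoxeterMatrix.IsRightAngled {S : Type*} (M : CoxeterMatrix S) : Prop :=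
  ∀ s t : S, M s t = 1 ∨ M s t = 2 ∨ M s t = 0

/-- An element `w` of a right-angled Coxeter group is firm if there is a unique generator `r` with
`l(w r) < l(w)`, that is, if all reduced words representing `w` end in the same letter `r`. -/
def CoxeterSystem.IsFirm {S W : Type*} [Group W] {M : CoxeterMatrix S} (cs : CoxeterSystem M W)
    (w : W) : Prop :=
  ∃! r : S, cs.length (w * cs.simple r) < cs.length w

/-- A graph with vertex set `C` whose edges are coloured by `S`:
`adj s c d` says that `c` and `d` are joined by an edge of colour `s`. -/
structure EdgeColoredGraph (S C : Type*) where
  adj : S → C → C → Prop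
  symm : ∀ {s : S} {c d : C}, adj s c d → adj s d c
  irrefl : ∀ (s : S) (c : C), ¬ adj s c c
  color_unique : ∀ {s t : S} {c d : C}, adj s c d → adj t c d → s = t

namespace EdgeColoredGraph

variable {S C : Type*}

/-- The `J`-residue containing `c`: the connected component of `c` in the subgraph formed by the
edges whose colour lies in `J`. -/
def residue (Γ : EdgeColoredGraph S C) (J : Set S) (c : C) : Set C :=
  {d | Relation.ReflTransGen (fun a b => ∃ s ∈ J, Γ.adj s a b) c d}

/-- The `s`-panel containing `c`. -/
def panel (Γ : EdgeColoredGraph S C) (s : S) (c : C) : Set C :=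
  Γ.residue {s} c

/-- `(v 0, …, v k)` is a gallery (of length `k`): consecutive chambers are adjacent. -/
def IsGallery (Γ : EdgeColoredGraph S C) {k : ℕ} (v : Fin (k + 1) → C) : Prop :=
  ∀ i : Fin k, ∃ s : S, Γ.adj s (v i.castSucc) (v i.succ)

/-- `(v 0, …, v k)` is a gallery of type `ω`, where `ω` is a word of length `k`. -/
def IsGalleryOfType (Γ : EdgeColoredGraph S C) (ω : List S) (v : Fin (ω.length + 1) → C) : Prop :=
  ∀ i : Fin ω.length, Γ.adj (ω.get i) (v i.castSucc) (v i.succ)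

/-- A gallery is minimal if no gallery with the same extremities is shorter. -/
def IsMinimalGallery (Γ : EdgeColoredGraph S C) {k : ℕ} (v : Fin (k + 1) → C) : Prop :=
  Γ.IsGallery v ∧ ∀ (m : ℕ) (u : Fin (m + 1) → C), Γ.IsGallery u →
    u 0 = v 0 → u (Fin.last m) = v (Fin.last k) → k ≤ m

/-- The group of type-preserving automorphisms. -/
def aut (Γ : EdgeColoredGraph S C) : Subgroup (Equiv.Perm C) where
  carrier := {g | ∀ (s : S) (c d : C), Γ.adj s (g c) (g d) ↔ Γ.adj s c d}
  one_mem' := fun _ _ _ => Iff.rfl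
  mul_mem' := fun {g h} hg hh s c d => (hg s (h c) (h d)).trans (hh s c d)
  inv_mem' := fun {g} hg s c d => by
    simpa using (hg s (g⁻¹ c) (g⁻¹ d)).symm

end EdgeColoredGraph

/-- A chamber system with index set `S` and set of chambers `C`: an edge-coloured graph all of whose
panels are complete graphs (of the respective colour) with at least two vertices. -/
structure ChamberSystem (S C : Type*) extends EdgeColoredGraph S C where
  panel_complete : ∀ (s : S) (c d e : C), d ∈ toEdgeColoredGraph.panel s c →
    e ∈ toEdgeColoredGraph.panel s c → d ≠ e → adj s d e
  panel_nontrivial : ∀ (s : S) (c : C), (toEdgeColoredGraph.panel s c).Nontrivial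

/-- A building of type `(W, S)` with set of chambers `C`: a chamber system with a Weyl distance. -/
structure Building {S W : Type*} [Group W] {M : CoxeterMatrix S} (cs : CoxeterSystem M W)
    (C : Type*) extends ChamberSystem S C where
  weylDist : C → C → W
  weylDist_eq_iff : ∀ (ω : List S), cs.IsReduced ω → ∀ c d : C,
    (weylDist c d = cs.wordProd ω ↔
      ∃ v : Fin (ω.length + 1) → C,
        toEdgeColoredGraph.IsGalleryOfType ω v ∧ v 0 = c ∧ v (Fin.last ω.length) = d)

namespace Building

variable {S W : Type*} [Group W] {M : CoxeterMatrix S} {cs : CoxeterSystem M W} {C : Type*}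

/-- Every panel contains at least three chambers. -/
def IsThick (Δ : Building cs C) : Prop :=
  ∀ (s : S) (c : C), 3 ≤ (Δ.panel s c).encard

/-- For each `s`, all `s`-panels have the same cardinality. -/
def IsSemiRegular (Δ : Building cs C) : Prop :=
  ∀ (s : S) (c d : C), Cardinal.mk (Δ.panel s c) = Cardinal.mk (Δ.panel s d)

/-- The gallery distance `l(δ(c, d))`. -/
noncomputable def galleryDist (Δ : Building cs C) (c d : C) : ℕ :=
  cs.length (Δ.weylDist c d)

/-- The ball of radius `n` around `c₀`. -/
def ball (Δ : Building cs C) (c₀ : C) (n : ℕ) : Set C :=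
  {c | Δ.galleryDist c₀ c ≤ n}

/-- The chamber `c` is firm with respect to `c₀`. -/
def IsFirm (Δ : Building cs C) (c₀ c : C) : Prop :=
  cs.IsFirm (Δ.weylDist c₀ c)

/-- The chamber `c` is `n`-flexible with respect to `c₀`: either it lies in the ball of radius `n`,
or for each minimal gallery `(c₀ = v 0, …, v (n + 1), …, v k = c)` none of the chambers
`v (n + 1), …, v k` is firm with respect to `c₀`. -/
def IsFlexible (Δ : Building cs C) (c₀ : C) (n : ℕ) (c : C) : Prop :=
  c ∈ Δ.ball c₀ n ∨
    ∀ (k : ℕ) (v : Fin (k + 1) → C), Δ.IsMinimalGallery v → v 0 = c₀ → v (Fin.last k) = c →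
      ∀ i : Fin (k + 1), n < (i : ℕ) → ¬ Δ.IsFirm c₀ (v i)

/-- The `n`-flex of `c₀`. -/
def flex (Δ : Building cs C) (c₀ : C) (n : ℕ) : Set C :=
  {c | Δ.IsFlexible c₀ n c}

/-- A set of chambers is bounded if it has finite diameter for the gallery distance. -/
def IsBoundedSet (Δ : Building cs C) (A : Set C) : Prop :=
  ∃ N : ℕ, ∀ c ∈ A, ∀ d ∈ A, Δ.galleryDist c d ≤ N

end Building

/-!
Write `l` for the length function of `W` and `δ` for the Weyl distance.

The Coxeter-theoretic input is a strong form of the exchange property: in a right-angled Coxeter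
group, a right descent of a reduced word occurs in this word and commutes with all the letters after
it (`CoxeterSystem.exists_eq_append_cons_forall_eq_two`). The plain exchange property is obtained by
counting reflections in inversion sequences modulo 2, and two distinct right descents commute because
a reduced word cannot end in alternating words of an infinite dihedral group of all lengths
(`CoxeterSystem.eq_two_of_isRightDescent`).

*Flexible chambers are fixed.* A chamber outside the ball which is not firm lies in two panels of
different types that contain chambers closer to `c₀`. Panels of different types share at most one
chamber, so by induction on the distance to `c₀` everything is fixed
(`Building.IsFlexible.apply_eq_of_forall_mem_ball`).

*Other chambers are moved.* If `c` is not flexible, then some minimal gallery from `c₀` to `c` passes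
through a firm chamber `a` outside the ball. Let `d` be the chamber before `a` and `r` the type of the
panel containing both. A gallery leaving the `r`-wing of `d` (the set of chambers projecting to `d`)
does so in the residue of `d` whose type consists of the generators commuting with `r`. Since `a` is
firm, `d` is the chamber of this residue closest to `c₀`, so the ball lies in the wing of `d`
(`Building.mem_wing_of_isFirm`). By thickness the panel contains a third chamber `e`, and
`Building.exists_mem_aut_exchanging_wings` provides an automorphism that exchanges the wings of `a` and
`e` and fixes all chambers outside of them. It fixes the ball, but it moves `c`, which lies in the wing
of `a`.

This automorphism is constructed from a legal colouring of the chambers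
(`Building.exists_legalColouring`), which exists by semi-regularity: permutations of the colours are
induced by automorphisms (`Building.LegalColouring.exists_map_of_colour_eq`). Exchanging the colours of
`a` and `e` yields an involution that exchanges the two wings. Along their boundary it moves chambers
only inside their `r`-panels, so replacing it by the identity outside the two wings preserves adjacency.

*The flex is bounded.* A reduced word leading to a flexible chamber contains no letter more than `n`
times (`Building.IsFlexible.count_le`), so its length is at most `n` times the number of generators.
-/

/-! ### Right-angled Coxeter groups -/

namespace CoxeterSystem

variable {S W : Type*} [Group W] {M : CoxeterMatrix S} (cs : CoxeterSystem M W)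

theorem simple_comm_of_eq_two {s t : S} (h : M s t = 2) : Commute (cs.simple s) (cs.simple t) := by
  have h1 := cs.simple_mul_simple_pow s t
  rw [h, pow_two] at h1
  have h2 := eq_inv_of_mul_eq_one_left h1
  rw [mul_inv_rev, cs.inv_simple, cs.inv_simple] at h2
  exact h2

theorem simple_comm_of_forall_eq_two {s : S} {ω : List S} (h : ∀ t ∈ ω, M s t = 2) :
    Commute (cs.simple s) (cs.wordProd ω) := by
  induction ω with
  | nil => simp
  | cons t ω ih =>
    rw [cs.wordProd_cons]
    exact (cs.simple_comm_of_eq_two (h t (by simp))).mul_right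
      (ih fun u hu => h u (by simp [hu]))

section RightAngled

variable (hM : M.IsRightAngled)
include hM

open Classical in
/-- In a right-angled Coxeter group, the number of letters `s` in a word is modulo `2` an invariant
of the element which the word represents. -/
theorem exists_parity (s : S) : ∃ φ : W →* ℤˣ, φ (cs.simple s) = -1 ∧
    ∀ t, t ≠ s → φ (cs.simple t) = 1 := by
  have hl : M.IsLiftable (fun t => if t = s then (-1 : ℤˣ) else 1) := by
    intro a b
    rcases hM a b with h | h | h
    · have hab : a = b := by
        by_contra hab
        exact M.off_diagonal a b hab h
      subst hab
      by_cases ha : a = s <;> simp [ha]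
    · rw [h]
      by_cases ha : a = s <;> by_cases hb : b = s <;> simp [ha, hb]
    · simp [h]
  refine ⟨cs.lift ⟨_, hl⟩, ?_, fun t ht => ?_⟩
  · rw [cs.lift_apply_simple hl]; simp
  · rw [cs.lift_apply_simple hl]; simp [ht]

theorem simple_injective_of_isRightAngled : Function.Injective cs.simple := by
  intro s t h
  by_contra hne
  obtain ⟨φ, h1, h2⟩ := cs.exists_parity hM s
  have := h2 t (Ne.symm hne)
  rw [← h, h1] at this
  exact absurd this (by decide)

theorem eq_of_isConj_simple {s t : S} {w : W}
    (h : cs.simple s = w⁻¹ * cs.simple t * w) : s = t := by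
  by_contra hne
  obtain ⟨φ, h1, h2⟩ := cs.exists_parity hM s
  have h3 := congrArg φ h
  rw [map_mul, map_mul, h1, h2 t (Ne.symm hne), map_inv, mul_one, inv_mul_cancel] at h3
  exact absurd h3 (by decide)

end RightAngled

open Classical in
/-- The action of a generator `s` on pairs of a group element and a sign: it conjugates the first
entry by `s`, and changes the sign if this entry is `s` itself. -/
noncomputable def signedConj (s : S) : Function.End (W × ZMod 2) :=
  fun p => (cs.simple s * p.1 * cs.simple s, p.2 + if p.1 = cs.simple s then 1 else 0)

open Classical in
theorem signedConj_apply (s : S) (w : W) (e : ZMod 2) : cs.signedConj s (w, e) =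
    (cs.simple s * w * cs.simple s, e + if w = cs.simple s then 1 else 0) := rfl

open Classical in
theorem signedConj_signedConj (s : S) : cs.signedConj s * cs.signedConj s = 1 := by
  funext p
  obtain ⟨w, e⟩ := p
  change cs.signedConj s (cs.signedConj s (w, e)) = (w, e)
  have h1 : cs.simple s * w * cs.simple s = cs.simple s ↔ w = cs.simple s := by
    constructor
    · intro h
      rwa [mul_assoc, mul_eq_left, mul_eq_one_iff_eq_inv, cs.inv_simple] at h
    · rintro rfl
      simp
  rw [signedConj_apply, signedConj_apply, if_congr h1 rfl rfl, Prod.mk.injEq]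
  refine ⟨by simp [mul_assoc], ?_⟩
  rw [add_assoc, CharTwo.add_self_eq_zero, add_zero]

open Classical in
theorem signedConj_comm {s t : S} (h : Commute (cs.simple s) (cs.simple t)) :
    cs.signedConj s * cs.signedConj t = cs.signedConj t * cs.signedConj s := by
  have key : ∀ {a b : S}, Commute (cs.simple a) (cs.simple b) → ∀ w : W,
      (cs.simple a * w * cs.simple a = cs.simple b ↔ w = cs.simple b) := by
    intro a b hab w
    constructor
    · intro h
      have h' : w = cs.simple a * (cs.simple a * w * cs.simple a) * cs.simple a := by
        simp [mul_assoc]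
      rw [h', h, hab.eq, mul_assoc, cs.simple_mul_simple_self, mul_one]
    · rintro rfl
      rw [hab.eq, mul_assoc, cs.simple_mul_simple_self, mul_one]
  funext p
  obtain ⟨w, e⟩ := p
  change cs.signedConj s (cs.signedConj t (w, e)) = cs.signedConj t (cs.signedConj s (w, e))
  simp only [signedConj_apply]
  rw [if_congr (key h w) rfl rfl, if_congr (key h.symm w) rfl rfl, Prod.mk.injEq]
  refine ⟨?_, add_right_comm _ _ _⟩
  simp only [← mul_assoc, h.eq]
  simp only [mul_assoc, h.eq]

section RightAngled

variable (hM : M.IsRightAngled)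
include hM

theorem isLiftable_signedConj : M.IsLiftable cs.signedConj := by
  intro a b
  rcases hM a b with h | h | h
  · have hab : a = b := by
      by_contra hab
      exact M.off_diagonal a b hab h
    subst hab
    rw [h, pow_one, cs.signedConj_signedConj]
  · rw [h, pow_two]
    nth_rw 1 [cs.signedConj_comm (cs.simple_comm_of_eq_two h)]
    rw [mul_assoc, ← mul_assoc (cs.signedConj a), cs.signedConj_signedConj, one_mul,
      cs.signedConj_signedConj]
  · simp [h]

open Classical in
/-- The parity of the multiplicity of a group element in the right inversion sequence of a word only
depends on the element which the word represents. -/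
theorem count_rightInvSeq_congr {ω ω' : List S} (h : cs.wordProd ω = cs.wordProd ω') (x : W) :
    (((cs.rightInvSeq ω).count x : ℕ) : ZMod 2) = ((cs.rightInvSeq ω').count x : ℕ) := by
  have hl := cs.isLiftable_signedConj hM
  have key : ∀ ω : List S, cs.lift ⟨_, hl⟩ (cs.wordProd ω) (x, 0) =
      (cs.wordProd ω * x * (cs.wordProd ω)⁻¹, ((cs.rightInvSeq ω).count x : ZMod 2)) := by
    intro ω
    induction ω with
    | nil =>
      rw [cs.wordProd_nil, map_one]
      change (x, (0 : ZMod 2)) = _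
      simp
    | cons s ω ih =>
      rw [cs.wordProd_cons, map_mul]
      change cs.lift ⟨_, hl⟩ (cs.simple s) (cs.lift ⟨_, hl⟩ (cs.wordProd ω) (x, 0)) = _
      rw [ih, cs.lift_apply_simple hl]
      refine Prod.ext ?_ ?_
      · simp [signedConj, mul_assoc]
      · simp only [signedConj, rightInvSeq, List.count_cons, Nat.cast_add]
        congr 1
        have : (cs.wordProd ω * x * (cs.wordProd ω)⁻¹ = cs.simple s) ↔
            ((cs.wordProd ω)⁻¹ * cs.simple s * cs.wordProd ω = x) := by
          constructor
          · intro h; rw [← h]; group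
          · intro h; rw [← h]; group
        by_cases h : (cs.wordProd ω)⁻¹ * cs.simple s * cs.wordProd ω = x
        · simp [this, h]
        · simp [this, h]
  have h1 := key ω
  rw [h, key ω'] at h1
  exact (congrArg Prod.snd h1).symm

theorem mem_rightInvSeq_of_isRightDescent {ω : List S} {t : S}
    (ht : cs.IsRightDescent (cs.wordProd ω) t) : cs.simple t ∈ cs.rightInvSeq ω := by
  classical
  obtain ⟨α, hα, hw⟩ := cs.exists_isReduced (cs.wordProd ω * cs.simple t)
  have h1 : cs.wordProd ω = cs.wordProd (α.concat t) := by
    rw [cs.wordProd_concat, ← hw, cs.simple_mul_simple_cancel_right]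
  have h2 : cs.IsReduced (α.concat t) := by
    have h3 := cs.isRightDescent_iff.1 ht
    rw [hw, hα.eq] at h3
    rw [IsReduced, ← h1, List.length_concat, h3]
  have h3 : (cs.rightInvSeq (α.concat t)).count (cs.simple t) = 1 := by
    apply List.count_eq_one_of_mem h2.nodup_rightInvSeq
    rw [cs.rightInvSeq_concat]
    simp
  have h4 := cs.count_rightInvSeq_congr hM h1 (cs.simple t)
  rw [h3] at h4
  rw [← List.count_pos_iff, Nat.pos_iff_ne_zero]
  intro h5
  rw [h5] at h4
  exact absurd h4 (by decide)

/-- The exchange property: a right descent of a word occurs in it, at a place from which it can be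
moved to the end. -/
theorem exists_eq_append_cons_of_isRightDescent {ω : List S} {t : S}
    (ht : cs.IsRightDescent (cs.wordProd ω) t) :
    ∃ ω₁ ω₂ : List S, ω = ω₁ ++ t :: ω₂ ∧ Commute (cs.simple t) (cs.wordProd ω₂) := by
  obtain ⟨j, hj, h⟩ := List.mem_iff_getElem.1 (cs.mem_rightInvSeq_of_isRightDescent hM ht)
  have hj' : j < ω.length := by simpa using hj
  rw [cs.getElem_rightInvSeq ω j hj', List.getElem?_eq_getElem hj'] at h
  simp only [Option.map_some, Option.getD_some] at h
  have hjt := cs.eq_of_isConj_simple hM h.symm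
  refine ⟨ω.take j, ω.drop (j + 1), ?_, ?_⟩
  · rw [hjt, ← List.drop_eq_getElem_cons hj', List.take_append_drop]
  · rw [← hjt] at h
    rw [mul_assoc, inv_mul_eq_iff_eq_mul] at h
    exact h

open Classical in
/-- If `s` and `t` generate an infinite dihedral group, then a word alternating between `s` and `t`
with last letter `s` does not have the inversion `t`. -/
theorem simple_notMem_rightInvSeq_alternatingWord {s t : S} (hst : s ≠ t) (h : M s t = 0) (k : ℕ) :
    cs.simple t ∉ cs.rightInvSeq (alternatingWord t s k) := by
  have hl : M.IsLiftable (fun u => if u = s then (DihedralGroup.sr 0 : DihedralGroup 0) else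
      if u = t then DihedralGroup.sr 1 else 1) := by
    intro a b
    rcases hM a b with hab | hab | hab
    · have hab' : a = b := by
        by_contra hab'
        exact M.off_diagonal a b hab' hab
      subst hab'
      rw [hab, pow_one]
      by_cases ha : a = s <;> by_cases hb : a = t <;> simp [ha, hb, hst.symm]
    · have h' : M t s = 0 := by rw [M.symmetric t s]; exact h
      rw [hab]
      by_cases ha : a = s <;> by_cases hb : b = s <;> by_cases ha' : a = t <;>
        by_cases hb' : b = t <;> simp_all [pow_two]
    · simp [hab]
  set φ := cs.lift ⟨_, hl⟩ with hφ
  have hs : φ (cs.simple s) = DihedralGroup.sr 0 := by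
    rw [hφ, cs.lift_apply_simple hl]; simp
  have ht : φ (cs.simple t) = DihedralGroup.sr 1 := by
    rw [hφ, cs.lift_apply_simple hl]; simp [Ne.symm hst]
  -- In the infinite dihedral group, the inversions of an alternating word are the reflections on
  -- one of the two sides of the wall between `s` and `t`.
  have key : ∀ k, (∀ x ∈ cs.rightInvSeq (alternatingWord t s k), ∃ i : ℤ, i ≤ 0 ∧
        φ x = DihedralGroup.sr (Int.cast i)) ∧
      (∀ x ∈ cs.rightInvSeq (alternatingWord s t k), ∃ i : ℤ, 1 ≤ i ∧
        φ x = DihedralGroup.sr (Int.cast i)) := by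
    intro k
    induction k with
    | zero => simp [alternatingWord]
    | succ k ih =>
      constructor
      · intro x hx
        rw [alternatingWord_succ, cs.rightInvSeq_concat, List.concat_eq_append,
          List.mem_append, List.mem_map, List.mem_singleton] at hx
        rcases hx with ⟨y, hy, rfl⟩ | rfl
        · obtain ⟨i, hi, hy'⟩ := ih.2 y hy
          refine ⟨0 - i, by lia, ?_⟩
          rw [MulAut.conj_apply, map_mul, map_mul, map_inv, hy', hs, DihedralGroup.inv_sr,
            DihedralGroup.sr_mul_sr, DihedralGroup.r_mul_sr]
          congr 1
          push_cast
          ring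
        · exact ⟨0, le_rfl, by rw [hs, Int.cast_zero]⟩
      · intro x hx
        rw [alternatingWord_succ, cs.rightInvSeq_concat, List.concat_eq_append,
          List.mem_append, List.mem_map, List.mem_singleton] at hx
        rcases hx with ⟨y, hy, rfl⟩ | rfl
        · obtain ⟨i, hi, hy'⟩ := ih.1 y hy
          refine ⟨2 - i, by lia, ?_⟩
          rw [MulAut.conj_apply, map_mul, map_mul, map_inv, hy', ht, DihedralGroup.inv_sr,
            DihedralGroup.sr_mul_sr, DihedralGroup.r_mul_sr]
          congr 1
          push_cast
          ring
        · exact ⟨1, le_rfl, by rw [ht, Int.cast_one]⟩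
  intro hmem
  obtain ⟨i, hi, h1⟩ := (key k).1 _ hmem
  rw [ht] at h1
  have h2 := DihedralGroup.sr.inj h1
  rw [← Int.cast_one, Int.cast_inj] at h2
  lia

/-- Two distinct right descents of an element of a right-angled Coxeter group commute. -/
theorem eq_two_of_isRightDescent {w : W} {s t : S} (hs : cs.IsRightDescent w s)
    (ht : cs.IsRightDescent w t) (hst : s ≠ t) : M s t = 2 := by
  rcases hM s t with h | h | h
  · exact absurd h (M.off_diagonal s t hst)
  · exact h
  exfalso
  have h' : M t s = 0 := by rw [M.symmetric t s]; exact h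
  -- Otherwise `w` has reduced words that end in arbitrarily long alternating words.
  have key : ∀ k : ℕ, (∃ α, cs.IsReduced (α ++ alternatingWord s t k) ∧
        cs.wordProd (α ++ alternatingWord s t k) = w) ∧
      (∃ α, cs.IsReduced (α ++ alternatingWord t s k) ∧
        cs.wordProd (α ++ alternatingWord t s k) = w) := by
    have step : ∀ {a b : S}, a ≠ b → M a b = 0 → cs.IsRightDescent w b → ∀ k,
        (∃ α, cs.IsReduced (α ++ alternatingWord b a k) ∧
          cs.wordProd (α ++ alternatingWord b a k) = w) →
        ∃ α, cs.IsReduced (α ++ alternatingWord a b (k + 1)) ∧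
          cs.wordProd (α ++ alternatingWord a b (k + 1)) = w := by
      rintro a b hab hab' hb k ⟨α, hα, rfl⟩
      obtain ⟨j, hj, h⟩ := List.mem_iff_getElem.1 (cs.mem_rightInvSeq_of_isRightDescent hM hb)
      have hj' : j < α.length + k := by simpa using hj
      by_cases hjα : j < α.length
      · have h1 := cs.wordProd_mul_getD_rightInvSeq (α ++ alternatingWord b a k) j
        rw [List.getD_eq_getElem _ _ hj, h, List.eraseIdx_append_of_lt_length hjα] at h1
        have h2 : cs.wordProd (α.eraseIdx j ++ alternatingWord a b (k + 1)) =
            cs.wordProd (α ++ alternatingWord b a k) := by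
          rw [alternatingWord_succ, List.concat_eq_append, ← List.append_assoc,
            ← List.concat_eq_append, cs.wordProd_concat, ← h1,
            cs.simple_mul_simple_cancel_right]
        refine ⟨α.eraseIdx j, ?_, h2⟩
        rw [IsReduced, h2, hα.eq]
        have := List.length_eraseIdx_add_one hjα
        simp only [List.length_append, length_alternatingWord]
        lia
      · refine absurd ?_ (cs.simple_notMem_rightInvSeq_alternatingWord hM hab hab' k)
        have h1 := cs.rightInvSeq_drop (α ++ alternatingWord b a k) α.length
        rw [List.drop_left] at h1
        rw [h1, ← h, List.mem_iff_getElem]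
        refine ⟨j - α.length, ?_, ?_⟩
        · simp; lia
        · rw [List.getElem_drop]
          congr 1
          lia
    intro k
    induction k with
    | zero =>
      obtain ⟨α, hα, hw⟩ := cs.exists_isReduced w
      exact ⟨⟨α, by simpa [alternatingWord] using hα, by simp [alternatingWord, hw]⟩,
        ⟨α, by simpa [alternatingWord] using hα, by simp [alternatingWord, hw]⟩⟩
    | succ k ih => exact ⟨step hst h ht k ih.2, step (Ne.symm hst) h' hs k ih.1⟩
  obtain ⟨α, hα, hw⟩ := (key (cs.length w + 1)).1
  rw [IsReduced, hw] at hα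
  simp at hα
  lia

end RightAngled

end CoxeterSystem

namespace CoxeterSystem

variable {S W : Type*} [Group W] {M : CoxeterMatrix S} (cs : CoxeterSystem M W)

theorem IsReduced.of_append_left {cs : CoxeterSystem M W} {α β : List S}
    (h : cs.IsReduced (α ++ β)) : cs.IsReduced α := by
  have := h.take α.length
  rwa [List.take_left] at this

theorem IsReduced.of_append_right {cs : CoxeterSystem M W} {α β : List S}
    (h : cs.IsReduced (α ++ β)) : cs.IsReduced β := by
  have := h.drop α.length
  rwa [List.drop_left] at this

theorem isReduced_append_singleton_iff {ω : List S} (hω : cs.IsReduced ω) {s : S} :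
    cs.IsReduced (ω ++ [s]) ↔ ¬ cs.IsRightDescent (cs.wordProd ω) s := by
  rw [cs.not_isRightDescent_iff, IsReduced, hω.eq, ← List.concat_eq_append, cs.wordProd_concat,
    List.length_concat]

/-- A letter that commutes with all the letters after it is a right descent. -/
theorem isRightDescent_of_forall_eq_two {α β : List S} {t : S}
    (h : cs.IsReduced (α ++ t :: β)) (hβ : ∀ u ∈ β, M t u = 2) :
    cs.IsRightDescent (cs.wordProd (α ++ t :: β)) t := by
  have hc := cs.simple_comm_of_forall_eq_two hβ
  have h1 : cs.wordProd (α ++ t :: β) * cs.simple t = cs.wordProd (α ++ β) := by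
    rw [cs.wordProd_append, cs.wordProd_cons, hc.eq, mul_assoc, mul_assoc,
      cs.simple_mul_simple_self, mul_one, cs.wordProd_append]
  rw [IsRightDescent, h1, h.eq]
  refine (cs.length_wordProd_le _).trans_lt ?_
  simp

section RightAngled

variable (hM : M.IsRightAngled)
include hM

theorem isReduced_pair {s t : S} (hst : s ≠ t) : cs.IsReduced [s, t] := by
  have h1 : cs.IsReduced [s] := by simp [IsReduced]
  refine (cs.isReduced_append_singleton_iff h1).2 fun h2 =>
    hst (cs.simple_injective_of_isRightAngled hM ?_)
  rw [cs.isRightDescent_iff] at h2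
  simp only [wordProd_cons, wordProd_nil, mul_one, length_simple] at h2
  rwa [Nat.add_eq_right, cs.length_eq_zero_iff, mul_eq_one_iff_eq_inv, cs.inv_simple] at h2

/-- If a generator `t` commutes with `w` and lengthens it, then `t` commutes with all the letters of
each reduced word for `w`. -/
theorem forall_eq_two_of_commute {t : S} {ω : List S} (hω : cs.IsReduced ω)
    (hc : Commute (cs.simple t) (cs.wordProd ω)) (ht : ¬ cs.IsRightDescent (cs.wordProd ω) t) :
    ∀ u ∈ ω, u ≠ t ∧ M t u = 2 := by
  induction ω using List.reverseRecOn with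
  | nil => simp
  | append_singleton ω u ih =>
    have hω' := hω.of_append_left
    have hw : cs.wordProd (ω ++ [u]) = cs.wordProd ω * cs.simple u := by
      rw [← List.concat_eq_append, cs.wordProd_concat]
    have hlen : cs.length (cs.wordProd ω * cs.simple u) = ω.length + 1 := by
      rw [← hw, hω.eq]; simp
    rw [hw] at hc ht
    rw [cs.not_isRightDescent_iff, hlen] at ht
    have hut : u ≠ t := by
      rintro rfl
      rw [cs.simple_mul_simple_cancel_right, hω'.eq] at ht
      lia
    -- Both `t` and `u` are right descents of `w t = t w`, where `w = π (ω ++ [u])`.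
    have hd : cs.IsRightDescent (cs.wordProd ω * cs.simple u * cs.simple t) t := by
      rw [IsRightDescent, cs.simple_mul_simple_cancel_right]
      lia
    have hd' : cs.IsRightDescent (cs.wordProd ω * cs.simple u * cs.simple t) u := by
      rw [IsRightDescent, ht, ← hc.eq, mul_assoc, cs.simple_mul_simple_cancel_right]
      have := cs.length_mul_le (cs.simple t) (cs.wordProd ω)
      rw [cs.length_simple, hω'.eq] at this
      lia
    have htu := cs.eq_two_of_isRightDescent hM hd hd' (Ne.symm hut)
    have hcu := cs.simple_comm_of_eq_two htu
    have hc' : Commute (cs.simple t) (cs.wordProd ω) := by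
      have := hc.mul_right hcu
      rwa [cs.simple_mul_simple_cancel_right] at this
    have hnd : ¬ cs.IsRightDescent (cs.wordProd ω) t := by
      intro h
      rw [cs.isRightDescent_iff, hω'.eq] at h
      rw [mul_assoc, ← hcu.eq, ← mul_assoc] at ht
      have := cs.length_mul_le (cs.wordProd ω * cs.simple t) (cs.simple u)
      rw [cs.length_simple] at this
      lia
    intro v hv
    rcases List.mem_append.1 hv with hv | hv
    · exact ih hω' hc' hnd v hv
    · rw [List.mem_singleton] at hv
      subst hv
      exact ⟨hut, htu⟩

/-- The exchange property in a right-angled Coxeter group: a right descent `t` of a reduced word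
occurs in it, and commutes with all the letters after it. -/
theorem exists_eq_append_cons_forall_eq_two {ω : List S} (hω : cs.IsReduced ω) {t : S}
    (ht : cs.IsRightDescent (cs.wordProd ω) t) :
    ∃ ω₁ ω₂ : List S, ω = ω₁ ++ t :: ω₂ ∧ (∀ u ∈ ω₂, u ≠ t ∧ M t u = 2) ∧
      cs.wordProd ω * cs.simple t = cs.wordProd (ω₁ ++ ω₂) ∧ cs.IsReduced (ω₁ ++ ω₂) := by
  obtain ⟨ω₁, ω₂, rfl, hc⟩ := cs.exists_eq_append_cons_of_isRightDescent hM ht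
  have h1 : cs.wordProd (ω₁ ++ t :: ω₂) * cs.simple t = cs.wordProd (ω₁ ++ ω₂) := by
    rw [cs.wordProd_append, cs.wordProd_cons, hc.eq, mul_assoc, mul_assoc,
      cs.simple_mul_simple_self, mul_one, cs.wordProd_append]
  have h2 : cs.IsReduced (ω₁ ++ ω₂) := by
    rw [cs.isRightDescent_iff, h1, hω.eq] at ht
    simp only [List.length_append, List.length_cons] at ht
    rw [IsReduced, List.length_append]
    lia
  have h3 := hω.of_append_right
  refine ⟨ω₁, ω₂, rfl, cs.forall_eq_two_of_commute hM h2.of_append_right hc ?_, h1, h2⟩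
  rw [cs.not_isRightDescent_iff, ← hc.eq, ← cs.wordProd_cons, h3.eq, h2.of_append_right.eq,
    List.length_cons]

/-- If `r` is a left descent of `w s` but not of `w`, then `s = r`, and `r` commutes with all the
letters of each reduced word for `w`. -/
theorem eq_and_forall_eq_two_of_isLeftDescent_mul {ω : List S} (hω : cs.IsReduced ω) {r s : S}
    (h : ¬ cs.IsLeftDescent (cs.wordProd ω) r)
    (h' : cs.IsLeftDescent (cs.wordProd ω * cs.simple s) r) :
    s = r ∧ ∀ u ∈ ω, u ≠ r ∧ M r u = 2 := by
  have h1 : cs.IsReduced (ω ++ [s]) := by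
    rw [cs.isReduced_append_singleton_iff hω, cs.not_isRightDescent_iff]
    rw [cs.not_isLeftDescent_iff] at h
    rw [cs.isLeftDescent_iff, ← mul_assoc] at h'
    rcases cs.length_mul_simple (cs.wordProd ω) s with h2 | h2
    · exact h2
    · rcases cs.length_mul_simple (cs.simple r * cs.wordProd ω) s with h3 | h3 <;> lia
  have h2 : cs.wordProd (s :: ω.reverse) = (cs.wordProd ω * cs.simple s)⁻¹ := by
    rw [cs.wordProd_cons, cs.wordProd_reverse, mul_inv_rev, cs.inv_simple]
  have h3 : cs.IsReduced (s :: ω.reverse) := by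
    have := h1.reverse
    rwa [List.reverse_append] at this
  have h4 : cs.IsRightDescent (cs.wordProd (s :: ω.reverse)) r := by
    rw [h2, cs.isRightDescent_inv_iff]
    exact h'
  obtain ⟨ω₁, ω₂, he, hω₂, -, -⟩ := cs.exists_eq_append_cons_forall_eq_two hM h3 h4
  cases ω₁ with
  | nil =>
    rw [List.nil_append, List.cons.injEq] at he
    refine ⟨he.1, fun u hu => hω₂ u ?_⟩
    rw [← he.2]
    simpa using hu
  | cons a ω₁ =>
    rw [List.cons_append, List.cons.injEq] at he
    refine absurd ?_ h
    rw [← cs.isRightDescent_inv_iff, ← cs.wordProd_reverse, he.2]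
    refine cs.isRightDescent_of_forall_eq_two ?_ fun u hu => (hω₂ u hu).2
    rw [← he.2]
    exact hω.reverse

/-- An element without right descents in a set `J` of generators is shortest in its left coset of
the subgroup generated by `J`. -/
theorem length_le_length_mul_wordProd {J : Set S} {u : W} (hu : ∀ s ∈ J, ¬ cs.IsRightDescent u s)
    {ω : List S} (hω : ∀ s ∈ ω, s ∈ J) : cs.length u ≤ cs.length (u * cs.wordProd ω) := by
  obtain ⟨α, hα, rfl⟩ := cs.exists_isReduced u
  suffices h : ∃ β : List S, (∀ s ∈ β, s ∈ J) ∧ cs.IsReduced (α ++ β) ∧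
      cs.wordProd α * cs.wordProd ω = cs.wordProd (α ++ β) by
    obtain ⟨β, -, hβ, he⟩ := h
    rw [he, hβ.eq, hα.eq]
    simp
  induction ω using List.reverseRecOn with
  | nil => exact ⟨[], by simp, by simpa using hα, by simp⟩
  | append_singleton ω t ih =>
    obtain ⟨β, hβJ, hβ, he⟩ := ih fun s hs => hω s (by simp [hs])
    have htJ : t ∈ J := hω t (by simp)
    have he' : cs.wordProd α * cs.wordProd (ω ++ [t]) =
        cs.wordProd (α ++ β) * cs.simple t := by
      rw [← he, ← List.concat_eq_append, cs.wordProd_concat, mul_assoc]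
    by_cases hd : cs.IsRightDescent (cs.wordProd (α ++ β)) t
    · obtain ⟨γ, ε, hγε, hε, h1, h2⟩ := cs.exists_eq_append_cons_forall_eq_two hM hβ hd
      rcases List.append_eq_append_iff.1 hγε with ⟨β', rfl, hβ'⟩ | ⟨α', hα', hα''⟩
      · refine ⟨β' ++ ε, fun s hs => hβJ s ?_, ?_, ?_⟩
        · rw [hβ']
          rcases List.mem_append.1 hs with hs | hs <;> simp [hs]
        · rwa [← List.append_assoc]
        · rw [he', h1, List.append_assoc]
      · cases α' with
        | nil =>
          rw [List.append_nil] at hα'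
          rw [List.nil_append] at hα''
          subst hα'
          refine ⟨ε, fun s hs => hβJ s ?_, h2, ?_⟩
          · rw [← hα'']
            simp [hs]
          · rw [he', h1]
        | cons a α' =>
          rw [List.cons_append, List.cons.injEq] at hα''
          obtain ⟨rfl, rfl⟩ := hα''
          subst hα'
          exact absurd (cs.isRightDescent_of_forall_eq_two hα fun u hu =>
            (hε u (by simp [hu])).2) (hu _ htJ)
    · refine ⟨β ++ [t], ?_, ?_, ?_⟩
      · intro s hs
        rcases List.mem_append.1 hs with hs | hs
        · exact hβJ s hs
        · rw [List.mem_singleton] at hs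
          rwa [hs]
      · rw [← List.append_assoc]
        exact (cs.isReduced_append_singleton_iff hβ).2 hd
      · rw [he', ← List.append_assoc, ← List.concat_eq_append, cs.wordProd_concat]

end RightAngled

end CoxeterSystem

/-! ### Galleries and the Weyl distance -/

namespace EdgeColoredGraph

variable {S C : Type*} (Γ : EdgeColoredGraph S C)

/-- There is a gallery of type `ω` from `c` to `d`; a recursive form of `IsGalleryOfType`. -/
def Joined : List S → C → C → Prop
  | [], c, d => c = d
  | s :: ω, c, d => ∃ e, Γ.adj s c e ∧ Joined ω e d

variable {Γ}

theorem joined_iff_exists_isGalleryOfType {ω : List S} {c d : C} : Γ.Joined ω c d ↔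
    ∃ v : Fin (ω.length + 1) → C, Γ.IsGalleryOfType ω v ∧ v 0 = c ∧ v (Fin.last ω.length) = d := by
  induction ω generalizing c with
  | nil =>
    constructor
    · rintro rfl
      exact ⟨fun _ => c, fun i => i.elim0, rfl, rfl⟩
    · rintro ⟨v, -, rfl, rfl⟩
      rfl
  | cons s ω ih =>
    constructor
    · rintro ⟨e, he, h⟩
      obtain ⟨v, hv, h0, h1⟩ := ih.1 h
      refine ⟨Fin.cons c v, fun i => ?_, rfl, ?_⟩
      · refine Fin.cases ?_ (fun i => ?_) i
        · change Γ.adj s c (v 0)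
          rwa [h0]
        · exact hv i
      · exact h1
    · rintro ⟨v, hv, rfl, rfl⟩
      exact ⟨v 1, hv 0, ih.2 ⟨fun i => v i.succ, fun i => hv i.succ, rfl, rfl⟩⟩

theorem joined_append {ω ω' : List S} {c d : C} :
    Γ.Joined (ω ++ ω') c d ↔ ∃ e, Γ.Joined ω c e ∧ Γ.Joined ω' e d := by
  induction ω generalizing c with
  | nil => simp [Joined]
  | cons s ω ih =>
    simp only [List.cons_append, Joined, ih]
    constructor
    · rintro ⟨a, ha, b, hb, hb'⟩
      exact ⟨b, ⟨a, ha, hb⟩, hb'⟩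
    · rintro ⟨b, ⟨a, ha, hb⟩, hb'⟩
      exact ⟨a, ha, b, hb, hb'⟩

theorem joined_append_singleton {ω : List S} {s : S} {c d : C} :
    Γ.Joined (ω ++ [s]) c d ↔ ∃ e, Γ.Joined ω c e ∧ Γ.adj s e d := by
  simp [joined_append, Joined]

theorem Joined.reverse {ω : List S} {c d : C} (h : Γ.Joined ω c d) : Γ.Joined ω.reverse d c := by
  induction ω generalizing c with
  | nil => exact h.symm
  | cons s ω ih =>
    obtain ⟨e, he, h⟩ := h
    rw [List.reverse_cons, joined_append_singleton]
    exact ⟨e, ih h, Γ.symm he⟩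

theorem Joined.map {ω : List S} {c d : C} {g : C → C}
    (hg : ∀ s c d, Γ.adj s c d → Γ.adj s (g c) (g d)) (h : Γ.Joined ω c d) :
    Γ.Joined ω (g c) (g d) := by
  induction ω generalizing c with
  | nil => exact congrArg g h
  | cons s ω ih =>
    obtain ⟨e, he, h⟩ := h
    exact ⟨g e, hg _ _ _ he, ih h⟩

end EdgeColoredGraph

namespace ChamberSystem

variable {S C : Type*} {Γ : ChamberSystem S C}

theorem self_mem_panel (s : S) (c : C) : c ∈ Γ.panel s c := Relation.ReflTransGen.refl

theorem mem_panel_iff {s : S} {c d : C} : d ∈ Γ.panel s c ↔ d = c ∨ Γ.adj s c d := by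
  constructor
  · intro h
    by_cases hd : d = c
    · exact Or.inl hd
    · exact Or.inr (Γ.panel_complete s c c d (self_mem_panel s c) h (Ne.symm hd))
  · rintro (rfl | h)
    · exact self_mem_panel s d
    · exact Relation.ReflTransGen.single ⟨s, rfl, h⟩

theorem mem_panel_of_adj {s : S} {c d : C} (h : Γ.adj s c d) : d ∈ Γ.panel s c :=
  mem_panel_iff.2 (Or.inr h)

theorem mem_panel_comm {s : S} {c d : C} : d ∈ Γ.panel s c ↔ c ∈ Γ.panel s d := by
  rw [mem_panel_iff, mem_panel_iff, eq_comm]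
  exact or_congr Iff.rfl ⟨Γ.symm, Γ.symm⟩

theorem panel_eq_of_mem {s : S} {c d : C} (h : d ∈ Γ.panel s c) : Γ.panel s d = Γ.panel s c := by
  ext e
  exact ⟨fun he => Relation.ReflTransGen.trans h he,
    fun he => Relation.ReflTransGen.trans (mem_panel_comm.1 h) he⟩

theorem ne_of_adj {s : S} {c d : C} (h : Γ.adj s c d) : c ≠ d := by
  rintro rfl
  exact Γ.irrefl s c h

theorem adj_of_mem_panel {s : S} {a c d : C} (hc : c ∈ Γ.panel s a) (hd : d ∈ Γ.panel s a)
    (h : c ≠ d) : Γ.adj s c d :=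
  Γ.panel_complete s a c d hc hd h

/-- Panels of different types share at most one chamber. -/
theorem eq_of_mem_panel_of_mem_panel {s t : S} (hst : s ≠ t) {c d : C} (hs : d ∈ Γ.panel s c)
    (ht : d ∈ Γ.panel t c) : d = c := by
  by_contra h
  exact hst (Γ.color_unique ((mem_panel_iff.1 hs).resolve_left h)
    ((mem_panel_iff.1 ht).resolve_left h))

end ChamberSystem

namespace Building

open EdgeColoredGraph ChamberSystem

variable {S W : Type*} [Group W] {M : CoxeterMatrix S} {cs : CoxeterSystem M W} {C : Type*}
  {Δ : Building cs C}

theorem weylDist_eq_wordProd_iff {ω : List S} (hω : cs.IsReduced ω) {c d : C} :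
    Δ.weylDist c d = cs.wordProd ω ↔ Δ.Joined ω c d := by
  rw [Δ.weylDist_eq_iff ω hω, joined_iff_exists_isGalleryOfType]

variable (Δ) in
theorem exists_joined (c d : C) : ∃ ω, cs.IsReduced ω ∧ Δ.weylDist c d = cs.wordProd ω ∧
    Δ.Joined ω c d := by
  obtain ⟨ω, hω, h⟩ := cs.exists_isReduced (Δ.weylDist c d)
  exact ⟨ω, hω, h, (weylDist_eq_wordProd_iff hω).1 h⟩

theorem weylDist_eq_one_iff {c d : C} : Δ.weylDist c d = 1 ↔ c = d := by
  have h : cs.IsReduced [] := by simp [CoxeterSystem.IsReduced]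
  have := weylDist_eq_wordProd_iff (Δ := Δ) h (c := c) (d := d)
  rwa [cs.wordProd_nil] at this

theorem weylDist_self (c : C) : Δ.weylDist c c = 1 := weylDist_eq_one_iff.2 rfl

theorem weylDist_symm (c d : C) : Δ.weylDist d c = (Δ.weylDist c d)⁻¹ := by
  obtain ⟨ω, hω, h, hj⟩ := Δ.exists_joined c d
  rw [h, ← cs.wordProd_reverse, weylDist_eq_wordProd_iff hω.reverse]
  exact hj.reverse

theorem galleryDist_comm (c d : C) : Δ.galleryDist c d = Δ.galleryDist d c := by
  rw [galleryDist, galleryDist, weylDist_symm d c, cs.length_inv]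

theorem galleryDist_eq_zero_iff {c d : C} : Δ.galleryDist c d = 0 ↔ c = d := by
  rw [galleryDist, cs.length_eq_zero_iff, weylDist_eq_one_iff]

theorem weylDist_of_adj_of_not_isRightDescent {x c d : C} {s : S} (h : Δ.adj s c d)
    (hs : ¬ cs.IsRightDescent (Δ.weylDist x c) s) :
    Δ.weylDist x d = Δ.weylDist x c * cs.simple s := by
  obtain ⟨ω, hω, hw, hj⟩ := Δ.exists_joined x c
  rw [hw] at hs ⊢
  have h1 := (cs.isReduced_append_singleton_iff hω).2 hs
  rw [← cs.wordProd_concat, List.concat_eq_append, weylDist_eq_wordProd_iff h1,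
    joined_append_singleton]
  exact ⟨c, hj, h⟩

variable (Δ) in
/-- The chamber `d` is the projection of `x` to the `s`-panel of `c`, and differs from `c`. -/
def Precedes (x : C) (s : S) (d c : C) : Prop :=
  Δ.adj s d c ∧ ¬ cs.IsRightDescent (Δ.weylDist x d) s

namespace Precedes

variable {x c d : C} {s t : S}

theorem weylDist_eq (h : Δ.Precedes x s d c) :
    Δ.weylDist x c = Δ.weylDist x d * cs.simple s :=
  weylDist_of_adj_of_not_isRightDescent h.1 h.2

theorem weylDist_eq' (h : Δ.Precedes x s d c) :
    Δ.weylDist x d = Δ.weylDist x c * cs.simple s := by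
  rw [h.weylDist_eq, cs.simple_mul_simple_cancel_right]

theorem isRightDescent (h : Δ.Precedes x s d c) : cs.IsRightDescent (Δ.weylDist x c) s := by
  rw [cs.isRightDescent_iff_not_isRightDescent_mul, ← h.weylDist_eq']
  exact h.2

theorem galleryDist_eq (h : Δ.Precedes x s d c) :
    Δ.galleryDist x c = Δ.galleryDist x d + 1 := by
  rw [galleryDist, galleryDist, h.weylDist_eq]
  exact cs.not_isRightDescent_iff.1 h.2

theorem galleryDist_lt (h : Δ.Precedes x s d c) : Δ.galleryDist x d < Δ.galleryDist x c := by
  rw [h.galleryDist_eq]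
  exact Nat.lt_succ_self _

theorem mem_panel (h : Δ.Precedes x s d c) : c ∈ Δ.panel s d := mem_panel_of_adj h.1

theorem mem_panel' (h : Δ.Precedes x s d c) : d ∈ Δ.panel s c := mem_panel_comm.1 h.mem_panel

end Precedes

variable (Δ) in
theorem exists_precedes {x c : C} {s : S} (h : cs.IsRightDescent (Δ.weylDist x c) s) :
    ∃ d, Δ.Precedes x s d c := by
  obtain ⟨ω, hω, hw⟩ := cs.exists_isReduced (Δ.weylDist x c * cs.simple s)
  have hs : ¬ cs.IsRightDescent (cs.wordProd ω) s := by
    rw [← hw, ← cs.isRightDescent_iff_not_isRightDescent_mul]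
    exact h
  have h1 := (cs.isReduced_append_singleton_iff hω).2 hs
  have h2 : Δ.weylDist x c = cs.wordProd (ω ++ [s]) := by
    rw [← List.concat_eq_append, cs.wordProd_concat, ← hw, cs.simple_mul_simple_cancel_right]
  obtain ⟨d, hd, hdc⟩ := joined_append_singleton.1 ((weylDist_eq_wordProd_iff h1).1 h2)
  refine ⟨d, hdc, ?_⟩
  rwa [(weylDist_eq_wordProd_iff hω).2 hd]

/-- Each panel contains a unique chamber closest to `x`. -/
theorem Precedes.unique {x c d d' : C} {s : S} (h : Δ.Precedes x s d c)
    (h' : Δ.Precedes x s d' c) : d = d' := by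
  by_contra hne
  have h1 : Δ.Precedes x s d d' := ⟨adj_of_mem_panel h.mem_panel' h'.mem_panel' hne, h.2⟩
  exact h'.2 h1.isRightDescent

variable (Δ) in
/-- The projection of `x` to the `s`-panel of `c`. -/
theorem exists_mem_panel_not_isRightDescent (x : C) (s : S) (c : C) :
    ∃ d ∈ Δ.panel s c, ¬ cs.IsRightDescent (Δ.weylDist x d) s := by
  by_cases h : cs.IsRightDescent (Δ.weylDist x c) s
  · obtain ⟨d, hd⟩ := Δ.exists_precedes h
    exact ⟨d, hd.mem_panel', hd.2⟩
  · exact ⟨c, self_mem_panel s c, h⟩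

theorem weylDist_eq_or_of_adj {x c d : C} {s : S} (h : Δ.adj s c d) :
    Δ.weylDist x d = Δ.weylDist x c ∨ Δ.weylDist x d = Δ.weylDist x c * cs.simple s := by
  obtain ⟨p, hp, hps⟩ := Δ.exists_mem_panel_not_isRightDescent x s c
  have hd : d ∈ Δ.panel s p := by
    rw [panel_eq_of_mem hp]
    exact mem_panel_of_adj h
  rcases mem_panel_iff.1 (mem_panel_comm.1 hp) with rfl | hc
  · exact Or.inr (weylDist_of_adj_of_not_isRightDescent h hps)
  · have hc' : Δ.Precedes x s p c := ⟨hc, hps⟩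
    rcases mem_panel_iff.1 hd with rfl | hd
    · exact Or.inr hc'.weylDist_eq'
    · have hd' : Δ.Precedes x s p d := ⟨hd, hps⟩
      exact Or.inl (hd'.weylDist_eq.trans hc'.weylDist_eq.symm)

theorem exists_sublist_weylDist_eq {x c d : C} {ω : List S} (h : Δ.Joined ω c d) :
    ∃ ω' : List S, ω'.Sublist ω ∧ Δ.weylDist x d = Δ.weylDist x c * cs.wordProd ω' := by
  induction ω generalizing c with
  | nil => exact ⟨[], List.Sublist.refl _, by rw [show c = d from h]; simp⟩
  | cons s ω ih =>
    obtain ⟨e, he, h⟩ := h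
    obtain ⟨ω', hω', h1⟩ := ih h
    rcases weylDist_eq_or_of_adj (x := x) he with h2 | h2
    · exact ⟨ω', hω'.cons s, by rw [h1, h2]⟩
    · exact ⟨s :: ω', hω'.cons_cons s, by rw [h1, h2, cs.wordProd_cons, mul_assoc]⟩

theorem galleryDist_le_of_joined {x c d : C} {ω : List S} (h : Δ.Joined ω c d) :
    Δ.galleryDist x d ≤ Δ.galleryDist x c + ω.length := by
  obtain ⟨ω', hω', h1⟩ := exists_sublist_weylDist_eq (x := x) h
  rw [galleryDist, h1]
  have h2 := cs.length_mul_le (Δ.weylDist x c) (cs.wordProd ω')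
  have h3 := cs.length_wordProd_le ω'
  have h4 := hω'.length_le
  rw [galleryDist]
  lia

theorem galleryDist_triangle (c d e : C) :
    Δ.galleryDist c e ≤ Δ.galleryDist c d + Δ.galleryDist d e := by
  obtain ⟨ω, hω, hw, hj⟩ := Δ.exists_joined d e
  have := galleryDist_le_of_joined (x := c) hj
  rwa [← hω.eq, ← hw] at this

/-- Induction on chambers by their distance to a given chamber. -/
theorem precedes_induction {x : C} {p : C → Prop} (h0 : p x)
    (h : ∀ c, (∀ d, Δ.galleryDist x d < Δ.galleryDist x c → p d) →
      ∀ s d, Δ.Precedes x s d c → p c) (c : C) : p c := by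
  induction hn : Δ.galleryDist x c using Nat.strong_induction_on generalizing c with
  | _ n ih =>
    by_cases hc : x = c
    · exact hc ▸ h0
    · obtain ⟨s, hs⟩ := cs.exists_rightDescent_of_ne_one (fun h1 => hc (weylDist_eq_one_iff.1 h1))
      obtain ⟨d, hd⟩ := Δ.exists_precedes hs
      exact h c (fun d hd' => ih _ (hn ▸ hd') d rfl) s d hd

theorem not_precedes_self {x d : C} {s : S} : ¬ Δ.Precedes x s d x := by
  intro h
  have h1 := h.galleryDist_lt
  rw [galleryDist_eq_zero_iff.2 rfl] at h1
  exact Nat.not_lt_zero _ h1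

theorem weylDist_map {g : C → C} (hg : ∀ s c d, Δ.adj s c d → Δ.adj s (g c) (g d)) (c d : C) :
    Δ.weylDist (g c) (g d) = Δ.weylDist c d := by
  obtain ⟨ω, hω, hw, hj⟩ := Δ.exists_joined c d
  rw [hw]
  exact (weylDist_eq_wordProd_iff hω).2 (hj.map hg)

section RightAngled

variable (hM : M.IsRightAngled)
include hM

/-- In a residue of type `{s, t}` with `s` and `t` commuting, galleries of type `(s, t)` can be
replaced by galleries of type `(t, s)`. -/
theorem exists_adj_adj_of_eq_two {s t : S} (hst : M s t = 2) {a b c : C} (hab : Δ.adj s a b)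
    (hbc : Δ.adj t b c) : ∃ d, Δ.adj t a d ∧ Δ.adj s d c := by
  have hne : s ≠ t := by
    rintro rfl
    rw [M.diagonal] at hst
    exact absurd hst (by decide)
  have h1 : Δ.weylDist a c = cs.wordProd [s, t] :=
    (weylDist_eq_wordProd_iff (cs.isReduced_pair hM hne)).2 ⟨b, hab, c, hbc, rfl⟩
  have h2 : cs.wordProd [s, t] = cs.wordProd [t, s] := by
    simpa [cs.wordProd_cons] using (cs.simple_comm_of_eq_two hst).eq
  rw [h2, weylDist_eq_wordProd_iff (cs.isReduced_pair hM hne.symm)] at h1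
  obtain ⟨d, hd, e, he, rfl⟩ := h1
  exact ⟨d, hd, he⟩

theorem exists_mem_panel_adj_of_eq_two {s t : S} (hst : M s t = 2) {a b c : C}
    (hab : b ∈ Δ.panel s a) (hbc : Δ.adj t b c) : ∃ d, Δ.adj t a d ∧ d ∈ Δ.panel s c := by
  rcases mem_panel_iff.1 hab with rfl | hab
  · exact ⟨c, hbc, self_mem_panel s c⟩
  · obtain ⟨d, hd, hdc⟩ := exists_adj_adj_of_eq_two hM hst hab hbc
    exact ⟨d, hd, mem_panel_comm.1 (mem_panel_of_adj hdc)⟩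

/-- If the panels of `c` of two different types both contain chambers closer to `x` than `c`, then
these types commute, and the residue of `c` spanned by them is a square at its far corner from `x`:
the projections `d` and `d'` of `x` to the two panels are both preceded by one chamber `e`. -/
theorem Precedes.diamond {x c d d' : C} {s t : S} (hst : s ≠ t) (h : Δ.Precedes x s d c)
    (h' : Δ.Precedes x t d' c) :
    M s t = 2 ∧ ∃ e, Δ.Precedes x t e d ∧ Δ.Precedes x s e d' := by
  have h2 := cs.eq_two_of_isRightDescent hM h.isRightDescent h'.isRightDescent hst
  refine ⟨h2, ?_⟩
  have hc := cs.simple_comm_of_eq_two h2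
  have hlen := h.galleryDist_eq
  have hlen' := h'.galleryDist_eq
  obtain ⟨ω, hω, hw⟩ := cs.exists_isReduced (Δ.weylDist x c)
  -- The exchange property shows that `t` is still a right descent of `δ x d`.
  have hd : cs.IsRightDescent (Δ.weylDist x d) t := by
    have h3 := h.isRightDescent
    have h4 := h'.isRightDescent
    rw [hw] at h3 h4
    obtain ⟨α, β, rfl, hβ, h5, h6⟩ := cs.exists_eq_append_cons_forall_eq_two hM hω h3
    rw [h.weylDist_eq', hw, h5]
    obtain ⟨γ, ε, hγ, hε, -, -⟩ := cs.exists_eq_append_cons_forall_eq_two hM hω h4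
    rcases List.append_eq_append_iff.1 hγ with ⟨β', rfl, hβ'⟩ | ⟨α', rfl, hα'⟩
    · cases β' with
      | nil => exact absurd (List.cons.inj hβ').1 hst
      | cons a β' =>
        rw [List.cons_append, List.cons.injEq] at hβ'
        obtain ⟨rfl, rfl⟩ := hβ'
        rw [← List.append_assoc] at h6 ⊢
        exact cs.isRightDescent_of_forall_eq_two h6 fun u hu => (hε u hu).2
    · cases α' with
      | nil => exact absurd (List.cons.inj hα').1.symm hst
      | cons a α' =>
        rw [List.cons_append, List.cons.injEq] at hα'
        obtain ⟨rfl, rfl⟩ := hα'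
        rw [List.append_assoc, List.cons_append] at h6 ⊢
        refine cs.isRightDescent_of_forall_eq_two h6 fun u hu => (hε u ?_).2
        rcases List.mem_append.1 hu with hu | hu <;> simp [hu]
  obtain ⟨e, he⟩ := Δ.exists_precedes hd
  refine ⟨e, he, ?_⟩
  obtain ⟨f, hef, hfc⟩ := exists_adj_adj_of_eq_two hM
    (show M t s = 2 by rw [M.symmetric t s]; exact h2) he.1 h.1
  have hes : ¬ cs.IsRightDescent (Δ.weylDist x e) s := by
    have h3 : Δ.weylDist x e * cs.simple s = Δ.weylDist x d' := by
      rw [he.weylDist_eq', h.weylDist_eq', h'.weylDist_eq', mul_assoc, mul_assoc,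
        ← hc.eq, cs.simple_mul_simple_cancel_left]
    have h4 := he.galleryDist_eq
    simp only [galleryDist] at hlen hlen' h4
    rw [CoxeterSystem.IsRightDescent, h3]
    lia
  have hef' : Δ.Precedes x s e f := ⟨hef, hes⟩
  have hfc' : Δ.Precedes x t f c := by
    refine ⟨hfc, ?_⟩
    have h3 := hef'.galleryDist_eq
    have h4 := he.galleryDist_eq
    have h5 : Δ.weylDist x f * cs.simple t = Δ.weylDist x c := by
      rw [hef'.weylDist_eq, he.weylDist_eq', h.weylDist_eq', mul_assoc, mul_assoc, mul_assoc,
        ← mul_assoc (cs.simple t), ← hc.eq, mul_assoc, cs.simple_mul_simple_self, mul_one,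
        cs.simple_mul_simple_self, mul_one]
    simp only [galleryDist] at hlen h3 h4
    rw [CoxeterSystem.IsRightDescent, h5]
    lia
  -- The chamber `f` that completes `e`, `d` and `c` to a square is `d'`.
  rwa [hfc'.unique h'] at hef'

end RightAngled

end Building

/-! ### Wings -/

namespace Building

open EdgeColoredGraph ChamberSystem

variable {S W : Type*} [Group W] {M : CoxeterMatrix S} {cs : CoxeterSystem M W} {C : Type*}
  {Δ : Building cs C}

variable (Δ) in
/-- The `r`-wing of `x`: the chambers whose projection to the `r`-panel of `x` is `x`. -/
def wing (r : S) (x : C) : Set C :=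
  {y | ¬ cs.IsLeftDescent (Δ.weylDist x y) r}

theorem mem_wing_iff {r : S} {x y : C} :
    y ∈ Δ.wing r x ↔ ¬ cs.IsRightDescent (Δ.weylDist y x) r := by
  rw [weylDist_symm x y, cs.isRightDescent_inv_iff]
  rfl

theorem notMem_wing_of_adj {r : S} {x x' y : C} (h : Δ.adj r x x') (hy : y ∈ Δ.wing r x) :
    y ∉ Δ.wing r x' := by
  rw [mem_wing_iff, not_not]
  exact Precedes.isRightDescent ⟨h, mem_wing_iff.1 hy⟩

theorem Precedes.mem_wing {x c d : C} {s : S} (h : Δ.Precedes x s d c) : x ∈ Δ.wing s d :=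
  mem_wing_iff.2 h.2

theorem mem_wing_map {g : C → C} (hg : ∀ s c d, Δ.adj s c d → Δ.adj s (g c) (g d)) {r : S}
    {x y : C} (h : y ∈ Δ.wing r x) : g y ∈ Δ.wing r (g x) := by
  rw [mem_wing_iff, weylDist_map hg]
  exact mem_wing_iff.1 h

section RightAngled

variable (hM : M.IsRightAngled)
include hM

/-- An edge leaving the `r`-wing of `x` has type `r`, and it starts in the residue of `x` whose type
consists of the generators commuting with `r`. -/
theorem eq_and_exists_joined_of_adj {r s : S} {x y z : C} (hy : y ∈ Δ.wing r x)
    (hz : z ∉ Δ.wing r x) (h : Δ.adj s y z) :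
    s = r ∧ ∃ ω, Δ.Joined ω x y ∧ ∀ u ∈ ω, u ≠ r ∧ M r u = 2 := by
  obtain ⟨ω, hω, hw, hj⟩ := Δ.exists_joined x y
  have hz' : cs.IsLeftDescent (Δ.weylDist x z) r := not_not.1 hz
  have hy' : ¬ cs.IsLeftDescent (Δ.weylDist x y) r := hy
  rcases weylDist_eq_or_of_adj (x := x) h with h1 | h1
  · rw [h1] at hz'
    exact absurd hz' hy'
  · rw [h1, hw] at hz'
    rw [hw] at hy'
    obtain ⟨h2, h3⟩ := cs.eq_and_forall_eq_two_of_isLeftDescent_mul hM hω hy' hz'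
    exact ⟨h2, ω, hj, h3⟩

/-- If `c` is firm with respect to `c₀`, and `d` is the chamber before `c` on a minimal gallery from
`c₀`, then all chambers closer to `c₀` than `c` lie in the same wing of the last panel as `d`: a
gallery from `c₀` leaves this wing through the residue of `d` whose type consists of the generators
commuting with `r`, and `d` is the chamber of this residue closest to `c₀`. -/
theorem mem_wing_of_isFirm {c₀ c d b : C} {r : S} (hc : Δ.IsFirm c₀ c) (h : Δ.Precedes c₀ r d c)
    (hb : Δ.galleryDist c₀ b < Δ.galleryDist c₀ c) : b ∈ Δ.wing r d := by
  revert hb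
  refine precedes_induction (Δ := Δ) (x := c₀) (p := fun b => Δ.galleryDist c₀ b < Δ.galleryDist c₀ c →
    b ∈ Δ.wing r d) (fun _ => h.mem_wing) ?_ b
  intro b ih s b' hb' hb
  by_contra hbd
  obtain ⟨-, ω, hω, hr⟩ := eq_and_exists_joined_of_adj hM
    (ih b' hb'.galleryDist_lt (hb'.galleryDist_lt.trans hb)) hbd hb'.1
  obtain ⟨ω', hω', h1⟩ := exists_sublist_weylDist_eq (x := c₀) hω
  have h2 : ∀ t ∈ {u | u ≠ r ∧ M r u = 2}, ¬ cs.IsRightDescent (Δ.weylDist c₀ d) t := by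
    rintro t ⟨htr, ht⟩ h3
    refine htr (hc.unique ?_ h.isRightDescent)
    have h4 := h.galleryDist_eq
    have h5 := cs.length_mul_le (Δ.weylDist c₀ d * cs.simple t) (cs.simple r)
    rw [cs.length_simple] at h5
    rw [cs.isRightDescent_iff] at h3
    simp only [galleryDist] at h4
    rw [h4, h.weylDist_eq, mul_assoc, (cs.simple_comm_of_eq_two ht).eq, ← mul_assoc]
    lia
  have h3 := cs.length_le_length_mul_wordProd hM h2 fun u hu => hr u (hω'.subset hu)
  rw [← h1] at h3
  have h4 := h.galleryDist_eq
  have h5 := hb'.galleryDist_eq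
  simp only [galleryDist] at h4 h5 hb
  lia

end RightAngled

/-! ### Legal colourings -/

/-- A legal colouring of the chambers: for each type `s`, a colouring that is constant on the panels
of all other types and bijective on each `s`-panel. -/
structure LegalColouring (Δ : Building cs C) (Q : S → Type*) where
  colour : ∀ s, C → Q s
  colour_eq_of_adj : ∀ {s t : S} {c d : C}, t ≠ s → Δ.adj t c d → colour s c = colour s d
  bijOn_panel : ∀ s c, Set.BijOn (colour s) (Δ.panel s c) Set.univ

/-- Colourings of a single type. Such a colouring is built by recursion on the distance to a base
chamber. If the base chamber has a projection `d ≠ c` to a `t`-panel of `c` with `t ≠ s`, then `c`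
inherits the colour of `d`; otherwise the `s`-panel of `c` is coloured by an arbitrary bijection that
extends the colour of the projection. -/
theorem exists_colour (hM : M.IsRightAngled) (x : C) (s : S) {Q : Type*}
    (hQ : ∀ c, ∃ f : C → Q, Set.BijOn f (Δ.panel s c) Set.univ) :
    ∃ f : C → Q, (∀ (t : S) (c d : C), t ≠ s → Δ.adj t c d → f c = f d) ∧
      ∀ c, Set.BijOn f (Δ.panel s c) Set.univ := by
  classical
  have hB : ∀ (c : C) (q : Q), ∃ f : C → Q, Set.BijOn f (Δ.panel s c) Set.univ ∧ f c = q := by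
    intro c q
    obtain ⟨f, hf⟩ := hQ c
    exact ⟨Equiv.swap (f c) q ∘ f,
      (Set.bijOn_univ.2 (Equiv.swap (f c) q).bijective).comp hf, by simp⟩
  choose B hB hB' using hB
  have hwf : WellFounded fun d c : C => Δ.galleryDist x d < Δ.galleryDist x c :=
    (measure fun c => Δ.galleryDist x c).wf
  let f : C → Q := hwf.fix fun c ih =>
    if h : ∃ p : S × C, p.1 ≠ s ∧ Δ.Precedes x p.1 p.2 c then
      ih h.choose.2 h.choose_spec.2.galleryDist_lt
    else if h : ∃ d, Δ.Precedes x s d c then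
      B h.choose (ih h.choose h.choose_spec.galleryDist_lt) c
    else (hQ c).choose c
  have hf : ∀ c, f c =
      if h : ∃ p : S × C, p.1 ≠ s ∧ Δ.Precedes x p.1 p.2 c then f h.choose.2
      else if h : ∃ d, Δ.Precedes x s d c then B h.choose (f h.choose) c
      else (hQ c).choose c := fun c => hwf.fix_eq _ c
  have hf1 : ∀ c, ∀ t d, t ≠ s → Δ.Precedes x t d c → f c = f d := by
    intro c
    refine precedes_induction (Δ := Δ) (x := x) (p := fun c => ∀ t d, t ≠ s → Δ.Precedes x t d c →
      f c = f d) (fun t d _ h => absurd h not_precedes_self) ?_ c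
    intro c ih _ _ _ t d ht hd
    have h : ∃ p : S × C, p.1 ≠ s ∧ Δ.Precedes x p.1 p.2 c := ⟨(t, d), ht, hd⟩
    rw [hf c, dif_pos h]
    obtain ⟨ht', hd'⟩ := h.choose_spec
    generalize h.choose.1 = t' at ht' hd'
    generalize h.choose.2 = d' at hd'
    by_cases htt : t' = t
    · subst htt
      rw [hd'.unique hd]
    · obtain ⟨-, e, he, he'⟩ := hd'.diamond hM htt hd
      rw [ih d' hd'.galleryDist_lt t e ht he, ih d hd.galleryDist_lt t' e ht' he']
  have hf2 : ∀ (t : S) (c d : C), t ≠ s → Δ.adj t c d → f c = f d := by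
    intro t c d ht hcd
    obtain ⟨p, hp, hpt⟩ := Δ.exists_mem_panel_not_isRightDescent x t c
    have key : ∀ e ∈ Δ.panel t c, f e = f p := by
      intro e he
      rw [← panel_eq_of_mem hp, mem_panel_iff] at he
      rcases he with rfl | he
      · rfl
      · exact hf1 e t p ht ⟨he, hpt⟩
    rw [key c (self_mem_panel t c), key d (mem_panel_of_adj hcd)]
  refine ⟨f, hf2, fun c => ?_⟩
  induction hn : Δ.galleryDist x c using Nat.strong_induction_on generalizing c with
  | _ n ih =>
    subst hn
    by_cases h1 : ∃ d, Δ.Precedes x s d c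
    · obtain ⟨d, hd⟩ := h1
      rw [← panel_eq_of_mem hd.mem_panel']
      exact ih _ hd.galleryDist_lt d rfl
    have hcs : ¬ cs.IsRightDescent (Δ.weylDist x c) s := fun h => h1 (Δ.exists_precedes h)
    by_cases h2 : ∃ t d, M s t = 2 ∧ Δ.Precedes x t d c
    · -- The `s`-panel of `c` is parallel to an `s`-panel that is closer to the base chamber.
      obtain ⟨t, d, hst, hd⟩ := h2
      have hts : t ≠ s := by
        rintro rfl
        rw [M.diagonal] at hst
        exact absurd hst (by decide)
      have hdb := ih _ hd.galleryDist_lt d rfl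
      have down : ∀ e ∈ Δ.panel s c, ∃ e' ∈ Δ.panel s d, Δ.adj t e e' := by
        intro e he
        obtain ⟨e', he', hde⟩ :=
          exists_mem_panel_adj_of_eq_two hM hst (mem_panel_comm.1 he) (Δ.symm hd.1)
        exact ⟨e', hde, he'⟩
      have up : ∀ e' ∈ Δ.panel s d, ∃ e ∈ Δ.panel s c, Δ.adj t e e' := by
        intro e' he'
        obtain ⟨e, he, hce⟩ :=
          exists_mem_panel_adj_of_eq_two hM hst (mem_panel_comm.1 he') hd.1
        exact ⟨e, hce, Δ.symm he⟩
      refine ⟨fun _ _ => Set.mem_univ _, ?_, ?_⟩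
      · intro e₁ he₁ e₂ he₂ he
        obtain ⟨e₁', h₁, h₁'⟩ := down e₁ he₁
        obtain ⟨e₂', h₂, h₂'⟩ := down e₂ he₂
        have : e₁' = e₂' := hdb.injOn h₁ h₂ (by
          rw [← hf2 t e₁ e₁' hts h₁', ← hf2 t e₂ e₂' hts h₂', he])
        subst this
        refine eq_of_mem_panel_of_mem_panel (Γ := Δ.toChamberSystem) hts (c := e₂) (d := e₁) ?_ ?_
        · rw [← panel_eq_of_mem (mem_panel_of_adj h₂')]
          exact mem_panel_of_adj (Δ.symm h₁')
        · rwa [panel_eq_of_mem he₂]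
      · intro q _
        obtain ⟨e', he', hq⟩ := hdb.surjOn (Set.mem_univ q)
        obtain ⟨e, he, hee⟩ := up e' he'
        exact ⟨e, he, by rw [hf2 t e e' hts hee, hq]⟩
    · -- The chambers of the panel other than `c` have no projection of a type other than `s`.
      refine (hB c (f c)).congr ?_
      intro e he
      rcases mem_panel_iff.1 he with rfl | he
      · exact hB' e (f e)
      · have hce : Δ.Precedes x s c e := ⟨he, hcs⟩
        have h3 : ¬ ∃ p : S × C, p.1 ≠ s ∧ Δ.Precedes x p.1 p.2 e := by
          rintro ⟨⟨t, d⟩, hts, hd⟩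
          obtain ⟨hst, d', hd', -⟩ := hce.diamond hM (Ne.symm hts) hd
          exact h2 ⟨t, d', hst, hd'⟩
        have h4 : ∃ d, Δ.Precedes x s d e := ⟨c, hce⟩
        rw [hf e, dif_neg h3, dif_pos h4, h4.choose_spec.unique hce]

theorem exists_legalColouring (hM : M.IsRightAngled) (hreg : Δ.IsSemiRegular) (x : C) :
    Nonempty (LegalColouring Δ fun s => Δ.panel s x) := by
  classical
  have h : ∀ s, ∃ f : C → Δ.panel s x, (∀ (t : S) (c d : C), t ≠ s → Δ.adj t c d → f c = f d) ∧
      ∀ c, Set.BijOn f (Δ.panel s c) Set.univ := by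
    intro s
    refine exists_colour hM x s fun c => ?_
    obtain ⟨e⟩ := Cardinal.eq.1 (hreg s c x)
    refine ⟨fun d => if hd : d ∈ Δ.panel s c then e ⟨d, hd⟩ else ⟨x, self_mem_panel s x⟩,
      fun _ _ => Set.mem_univ _, ?_, ?_⟩
    · intro a ha b hb hab
      simp only [dif_pos ha, dif_pos hb] at hab
      exact congrArg Subtype.val (e.injective hab)
    · intro q _
      refine ⟨(e.symm q).1, (e.symm q).2, ?_⟩
      simp
  choose f hf hf' using h
  exact ⟨⟨f, fun hts hcd => hf _ _ _ _ hts hcd, hf'⟩⟩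

namespace LegalColouring

variable {Q : S → Type*} (L : LegalColouring Δ Q)

theorem eq_of_mem_panel {s : S} {c d e : C} (hd : d ∈ Δ.panel s c) (he : e ∈ Δ.panel s c)
    (h : L.colour s d = L.colour s e) : d = e :=
  (L.bijOn_panel s c).injOn hd he h

theorem colour_eq_of_mem_panel {s t : S} {c d : C} (hts : t ≠ s) (h : d ∈ Δ.panel t c) :
    L.colour s d = L.colour s c := by
  rcases mem_panel_iff.1 h with rfl | h
  · rfl
  · exact (L.colour_eq_of_adj hts h).symm

/-- The chamber of colour `q` in the `s`-panel of `c`. -/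
noncomputable def move (s : S) (q : Q s) (c : C) : C :=
  ((L.bijOn_panel s c).surjOn (Set.mem_univ q)).choose

theorem move_mem_panel (s : S) (q : Q s) (c : C) : L.move s q c ∈ Δ.panel s c :=
  ((L.bijOn_panel s c).surjOn (Set.mem_univ q)).choose_spec.1

theorem colour_move (s : S) (q : Q s) (c : C) : L.colour s (L.move s q c) = q :=
  ((L.bijOn_panel s c).surjOn (Set.mem_univ q)).choose_spec.2

theorem move_eq {s : S} {q : Q s} {c d : C} (hd : d ∈ Δ.panel s c) (hq : L.colour s d = q) :
    L.move s q c = d :=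
  L.eq_of_mem_panel (L.move_mem_panel s q c) hd ((L.colour_move s q c).trans hq.symm)

theorem move_comm (hM : M.IsRightAngled) {s t : S} (hst : M s t = 2) (a : Q s) (b : Q t) (c : C) :
    L.move t b (L.move s a c) = L.move s a (L.move t b c) := by
  have hne : s ≠ t := by
    rintro rfl
    rw [M.diagonal] at hst
    exact absurd hst (by decide)
  obtain ⟨d, hd, hd'⟩ : ∃ d, d ∈ Δ.panel t c ∧ L.move t b (L.move s a c) ∈ Δ.panel s d := by
    rcases mem_panel_iff.1 (L.move_mem_panel t b (L.move s a c)) with h | h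
    · exact ⟨c, self_mem_panel t c, by rw [h]; exact L.move_mem_panel s a c⟩
    · obtain ⟨d, hd, hd'⟩ := exists_mem_panel_adj_of_eq_two hM hst (L.move_mem_panel s a c) h
      exact ⟨d, mem_panel_of_adj hd, mem_panel_comm.1 hd'⟩
  have h1 : L.move t b c = d := L.move_eq hd (by
    rw [← L.colour_eq_of_mem_panel hne hd', L.colour_move])
  rw [h1]
  refine (L.move_eq hd' ?_).symm
  rw [L.colour_eq_of_mem_panel hne.symm (L.move_mem_panel t b _), L.colour_move]

/-- Maps that preserve panels are determined by the colours of their values and by their value at one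
chamber. -/
theorem eq_of_colour_eq {h h' : C → C} (hp : ∀ s c d, d ∈ Δ.panel s c → h d ∈ Δ.panel s (h c))
    (hp' : ∀ s c d, d ∈ Δ.panel s c → h' d ∈ Δ.panel s (h' c))
    (hc : ∀ s c, L.colour s (h c) = L.colour s (h' c)) {x : C} (hx : h x = h' x) : h = h' := by
  funext c
  refine precedes_induction (Δ := Δ) (x := x) (p := fun c => h c = h' c) hx ?_ c
  intro c ih s d hd
  refine L.eq_of_mem_panel (hp s d c hd.mem_panel) ?_ (hc s c)
  rw [ih d hd.galleryDist_lt]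
  exact hp' s d c hd.mem_panel

/-- Maps of the colours are induced by maps that preserve panels. The value at `c` is
determined by the values at the chambers preceding `c` on minimal galleries from `x`. -/
theorem exists_map_of_colour_eq (hM : M.IsRightAngled) (σ : ∀ s, Q s → Q s) {x e : C}
    (hxe : ∀ s, L.colour s e = σ s (L.colour s x)) :
    ∃ h : C → C, h x = e ∧ (∀ s c, L.colour s (h c) = σ s (L.colour s c)) ∧
      ∀ s c d, d ∈ Δ.panel s c → h d ∈ Δ.panel s (h c) := by
  classical
  have hwf : WellFounded fun d c : C => Δ.galleryDist x d < Δ.galleryDist x c :=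
    (measure fun c => Δ.galleryDist x c).wf
  let h : C → C := hwf.fix fun c ih =>
    if hp : ∃ p : S × C, Δ.Precedes x p.1 p.2 c then
      L.move hp.choose.1 (σ _ (L.colour hp.choose.1 c))
        (ih hp.choose.2 hp.choose_spec.galleryDist_lt)
    else e
  have hh : ∀ c, h c = if hp : ∃ p : S × C, Δ.Precedes x p.1 p.2 c then
      L.move hp.choose.1 (σ _ (L.colour hp.choose.1 c)) (h hp.choose.2) else e :=
    fun c => hwf.fix_eq _ c
  have hx : h x = e := by
    rw [hh, dif_neg]
    rintro ⟨p, hp⟩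
    exact not_precedes_self hp
  have hmove : ∀ c, ∀ s d, Δ.Precedes x s d c → h c = L.move s (σ s (L.colour s c)) (h d) := by
    intro c
    refine precedes_induction (Δ := Δ) (x := x) (p := fun c => ∀ s d, Δ.Precedes x s d c →
      h c = L.move s (σ s (L.colour s c)) (h d)) (fun s d h => absurd h not_precedes_self) ?_ c
    intro c ih _ _ _ s d hd
    have hp : ∃ p : S × C, Δ.Precedes x p.1 p.2 c := ⟨(s, d), hd⟩
    rw [hh c, dif_pos hp]
    have hd' := hp.choose_spec
    generalize hp.choose.1 = t at hd' ⊢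
    generalize hp.choose.2 = d' at hd' ⊢
    by_cases hts : t = s
    · subst hts
      rw [hd'.unique hd]
    · obtain ⟨h2, g, hg, hg'⟩ := hd'.diamond hM hts hd
      rw [ih d' hd'.galleryDist_lt s g hg, ih d hd.galleryDist_lt t g hg',
        L.colour_eq_of_mem_panel hts hd'.mem_panel',
        L.colour_eq_of_mem_panel (Ne.symm hts) hd.mem_panel', L.move_comm hM h2]
  have hcol : ∀ c s, L.colour s (h c) = σ s (L.colour s c) := by
    intro c
    refine precedes_induction (Δ := Δ) (x := x)
      (p := fun c => ∀ s, L.colour s (h c) = σ s (L.colour s c))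
      (fun s => by rw [hx, hxe]) ?_ c
    intro c ih t d hd s
    rw [hmove c t d hd]
    by_cases hts : t = s
    · subst hts
      exact L.colour_move _ _ _
    · rw [L.colour_eq_of_mem_panel hts (L.move_mem_panel _ _ _), ih d hd.galleryDist_lt,
        L.colour_eq_of_mem_panel hts hd.mem_panel']
  refine ⟨h, hx, fun s c => hcol c s, fun s c d hcd => ?_⟩
  obtain ⟨p, hp, hps⟩ := Δ.exists_mem_panel_not_isRightDescent x s c
  have key : ∀ a ∈ Δ.panel s c, h a ∈ Δ.panel s (h p) := by
    intro a ha
    rw [← panel_eq_of_mem hp, mem_panel_iff] at ha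
    rcases ha with rfl | ha
    · exact self_mem_panel s _
    · rw [hmove a s p ⟨ha, hps⟩]
      exact L.move_mem_panel _ _ _
  rw [panel_eq_of_mem (key c (self_mem_panel s c))]
  exact key d hcd

end LegalColouring

/-! ### Exchanging two wings -/

section RightAngled

variable (hM : M.IsRightAngled)
include hM

/-- Exchanging the colours of `x` and `e` is induced by an involution of the building. On the residues
of `x` and `e` whose type consists of the generators commuting with `r`, it maps each chamber into the
`r`-panel of this chamber. As edges leave the wings of `x` and `e` only in these residues, the
involution can be replaced by the identity outside the two wings. -/
theorem exists_mem_aut_exchanging_wings (hreg : Δ.IsSemiRegular) {r : S} {x e : C}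
    (hxe : Δ.adj r x e) :
    ∃ g ∈ Δ.aut, (∀ y, y ∉ Δ.wing r x → y ∉ Δ.wing r e → g y = y) ∧
      ∀ y ∈ Δ.wing r x, g y ∈ Δ.wing r e := by
  classical
  obtain ⟨L⟩ := exists_legalColouring hM hreg x
  -- For `s ≠ r` this exchanges two equal colours.
  let σ : ∀ s, Equiv.Perm (Δ.panel s x) := fun s => Equiv.swap (L.colour s x) (L.colour s e)
  have hσ : ∀ s ≠ r, ∀ q, σ s q = q := by
    intro s hs q
    simp only [σ, L.colour_eq_of_adj (Ne.symm hs) hxe, Equiv.swap_self, Equiv.refl_apply]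
  obtain ⟨h, hx, hcol, hpan⟩ := L.exists_map_of_colour_eq hM (fun s q => σ s q)
    (x := x) (e := e) (fun s => (Equiv.swap_apply_left _ _).symm)
  have he : h e = x := by
    have h1 : h e ∈ Δ.panel r e := by
      have := hpan r x e (mem_panel_of_adj hxe)
      rwa [hx] at this
    refine L.eq_of_mem_panel h1 (mem_panel_of_adj (Δ.symm hxe)) ?_
    rw [hcol]
    exact Equiv.swap_apply_right _ _
  have hinv : ∀ c, h (h c) = c := by
    refine congrFun (L.eq_of_colour_eq (h := fun c => h (h c)) (h' := fun c => c) ?_ ?_ ?_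
      (x := x) ?_)
    · exact fun s c d hd => hpan _ _ _ (hpan _ _ _ hd)
    · exact fun s c d hd => hd
    · intro s c
      simp only [hcol, σ, Equiv.swap_apply_self]
    · simp only [hx, he]
  have hadj : ∀ s c d, Δ.adj s c d → Δ.adj s (h c) (h d) := by
    intro s c d hcd
    refine adj_of_mem_panel (self_mem_panel s _) (hpan s c d (mem_panel_of_adj hcd)) fun h1 => ?_
    refine ne_of_adj hcd ?_
    rw [← hinv c, h1, hinv]
  have hres : ∀ p, h p ∈ Δ.panel r p → ∀ ω y, Δ.Joined ω p y → (∀ u ∈ ω, u ≠ r ∧ M r u = 2) →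
      h y ∈ Δ.panel r y := by
    intro p hp ω
    induction ω using List.reverseRecOn with
    | nil =>
      rintro y rfl -
      exact hp
    | append_singleton ω t ih =>
      intro y hy hω
      obtain ⟨z, hz, hzy⟩ := joined_append_singleton.1 hy
      have hz' := ih z hz fun u hu => hω u (by simp [hu])
      obtain ⟨htr, ht⟩ := hω t (by simp)
      -- The last vertex of the square with vertices `z`, `h z` and `y` is `h y`.
      obtain ⟨f, hf, hfy⟩ := exists_mem_panel_adj_of_eq_two hM ht (mem_panel_comm.1 hz') hzy
      have h1 : h y = f := by
        refine L.eq_of_mem_panel (hpan t z y (mem_panel_of_adj hzy)) (mem_panel_of_adj hf) ?_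
        rw [hcol, hσ t htr, L.colour_eq_of_mem_panel htr.symm hfy]
      rw [h1]
      exact hfy
  have hwx : ∀ y ∈ Δ.wing r x, h y ∈ Δ.wing r e := fun y hy => hx ▸ mem_wing_map hadj hy
  have hwe : ∀ y ∈ Δ.wing r e, h y ∈ Δ.wing r x := fun y hy => he ▸ mem_wing_map hadj hy
  set D : Set C := Δ.wing r x ∪ Δ.wing r e with hD
  have hDh : ∀ y ∈ D, h y ∈ D := by
    rintro y (hy | hy)
    · exact Or.inr (hwx y hy)
    · exact Or.inl (hwe y hy)
  have hbd : ∀ s y z, y ∈ D → z ∉ D → Δ.adj s y z → Δ.adj s (h y) z := by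
    intro s y z hy hz hyz
    obtain ⟨rfl, hyr⟩ : s = r ∧ h y ∈ Δ.panel r y := by
      rcases hy with hy | hy
      · obtain ⟨h1, ω, hω, hωr⟩ :=
          eq_and_exists_joined_of_adj hM hy (fun h' => hz (Or.inl h')) hyz
        refine ⟨h1, hres x ?_ ω y hω hωr⟩
        rw [hx]
        exact mem_panel_of_adj hxe
      · obtain ⟨h1, ω, hω, hωr⟩ :=
          eq_and_exists_joined_of_adj hM hy (fun h' => hz (Or.inr h')) hyz
        refine ⟨h1, hres e ?_ ω y hω hωr⟩
        rw [he]
        exact mem_panel_of_adj (Δ.symm hxe)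
    refine adj_of_mem_panel hyr (mem_panel_of_adj hyz) ?_
    rintro rfl
    exact hz (hDh y hy)
  let g : C → C := fun y => if y ∈ D then h y else y
  have hg1 : ∀ y ∈ D, g y = h y := fun y hy => if_pos hy
  have hg2 : ∀ y ∉ D, g y = y := fun y hy => if_neg hy
  have hginv : Function.Involutive g := by
    intro y
    by_cases hy : y ∈ D
    · rw [hg1 y hy, hg1 _ (hDh y hy), hinv]
    · rw [hg2 y hy, hg2 y hy]
  have hgadj : ∀ s c d, Δ.adj s c d → Δ.adj s (g c) (g d) := by
    intro s c d hcd
    by_cases hc : c ∈ D <;> by_cases hd : d ∈ D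
    · rw [hg1 c hc, hg1 d hd]
      exact hadj s c d hcd
    · rw [hg1 c hc, hg2 d hd]
      exact hbd s c d hc hd hcd
    · rw [hg2 c hc, hg1 d hd]
      exact Δ.symm (hbd s d c hd hc (Δ.symm hcd))
    · rw [hg2 c hc, hg2 d hd]
      exact hcd
  refine ⟨hginv.toPerm, fun s c d => ⟨fun hcd => ?_, fun hcd => hgadj s c d hcd⟩, ?_, ?_⟩
  · have := hgadj s _ _ hcd
    simp only [Function.Involutive.coe_toPerm] at this
    rwa [hginv c, hginv d] at this
  · intro y hyx hye
    exact hg2 y fun h' => h'.elim hyx hye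
  · intro y hy
    change g y ∈ _
    rw [hg1 y (Or.inl hy)]
    exact hwx y hy

end RightAngled

end Building

/-! ### Minimal galleries and flexible chambers -/

namespace Building

open EdgeColoredGraph ChamberSystem

variable {S W : Type*} [Group W] {M : CoxeterMatrix S} {cs : CoxeterSystem M W} {C : Type*}
  {Δ : Building cs C}

theorem galleryDist_succ_le_of_adj {x c d : C} {s : S} (h : Δ.adj s c d) :
    Δ.galleryDist x d ≤ Δ.galleryDist x c + 1 :=
  galleryDist_le_of_joined (ω := [s]) ⟨d, h, rfl⟩

theorem galleryDist_le_of_isGallery {k : ℕ} {v : Fin (k + 1) → C} (hv : Δ.IsGallery v)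
    {i j : Fin (k + 1)} (hij : i ≤ j) : Δ.galleryDist (v i) (v j) ≤ j - i := by
  have key : ∀ m : ℕ, ∀ hm : i + m < k + 1, Δ.galleryDist (v i) (v ⟨i + m, hm⟩) ≤ m := by
    intro m
    induction m with
    | zero => exact fun _ => (galleryDist_eq_zero_iff.2 rfl).le
    | succ m ih =>
      intro hm
      obtain ⟨s, hs⟩ := hv ⟨i + m, by lia⟩
      exact (galleryDist_succ_le_of_adj hs).trans (Nat.succ_le_succ (ih (by lia)))
  have hij' : (i : ℕ) ≤ j := hij
  have := key (j - i) (by lia)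
  rwa [show (⟨i + (j - i), by lia⟩ : Fin (k + 1)) = j from Fin.ext (by simp; lia)] at this

variable (Δ) in
theorem exists_isGallery (c d : C) : ∃ v : Fin (Δ.galleryDist c d + 1) → C,
    Δ.IsGallery v ∧ v 0 = c ∧ v (Fin.last _) = d := by
  obtain ⟨ω, hω, hw, hj⟩ := Δ.exists_joined c d
  have h : Δ.galleryDist c d = ω.length := by rw [galleryDist, hw, hω.eq]
  rw [h]
  obtain ⟨v, hv, h0, h1⟩ := joined_iff_exists_isGalleryOfType.1 hj
  exact ⟨v, fun i => ⟨_, hv i⟩, h0, h1⟩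

theorem isMinimalGallery_iff {k : ℕ} {v : Fin (k + 1) → C} : Δ.IsMinimalGallery v ↔
    Δ.IsGallery v ∧ Δ.galleryDist (v 0) (v (Fin.last k)) = k := by
  refine and_congr_right fun hv => ⟨fun h => ?_, fun h m u hu h0 h1 => ?_⟩
  · refine le_antisymm (galleryDist_le_of_isGallery hv (Fin.zero_le _)) ?_
    obtain ⟨u, hu, h0, h1⟩ := Δ.exists_isGallery (v 0) (v (Fin.last k))
    exact h _ u hu h0 h1
  · rw [← h, ← h0, ← h1]
    exact galleryDist_le_of_isGallery hu (Fin.zero_le _)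

theorem galleryDist_eq_of_isMinimalGallery {k : ℕ} {v : Fin (k + 1) → C}
    (hv : Δ.IsMinimalGallery v) {i j : Fin (k + 1)} (hij : i ≤ j) :
    Δ.galleryDist (v i) (v j) = j - i := by
  obtain ⟨hg, hk⟩ := isMinimalGallery_iff.1 hv
  have h1 := galleryDist_le_of_isGallery hg hij
  have h2 := galleryDist_le_of_isGallery hg (Fin.zero_le i)
  have h3 := galleryDist_le_of_isGallery hg (Fin.le_last j)
  have h4 := galleryDist_triangle (Δ := Δ) (v 0) (v i) (v (Fin.last k))
  have h5 := galleryDist_triangle (Δ := Δ) (v i) (v j) (v (Fin.last k))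
  have hij' : (i : ℕ) ≤ j := hij
  simp only [Fin.val_last, Fin.val_zero] at h2 h3
  lia

namespace IsFlexible

variable {c₀ c d : C} {n : ℕ}

theorem not_isFirm (h : Δ.IsFlexible c₀ n c) (hn : n < Δ.galleryDist c₀ c) :
    ¬ Δ.IsFirm c₀ c := by
  have h' := h.resolve_left (Nat.not_le.2 hn)
  obtain ⟨v, hv, h0, h1⟩ := Δ.exists_isGallery c₀ c
  have := h' _ v (isMinimalGallery_iff.2 ⟨hv, by rw [h0, h1]⟩) h0 h1 (Fin.last _) hn
  rwa [h1] at this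

theorem of_precedes (h : Δ.IsFlexible c₀ n c) {s : S} (hd : Δ.Precedes c₀ s d c) :
    Δ.IsFlexible c₀ n d := by
  rcases h with h | h
  · exact Or.inl (hd.galleryDist_lt.le.trans h)
  refine Or.inr fun k v hv h0 h1 i hi => ?_
  obtain ⟨hg, hk⟩ := isMinimalGallery_iff.1 hv
  rw [h0, h1] at hk
  have hg' : Δ.IsGallery (Fin.snoc (α := fun _ => C) v c) := by
    intro j
    refine Fin.lastCases ?_ (fun j => ?_) j
    · refine ⟨s, ?_⟩
      rw [Fin.snoc_castSucc, Fin.succ_last, Fin.snoc_last, h1]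
      exact hd.1
    · obtain ⟨t, ht⟩ := hg j
      refine ⟨t, ?_⟩
      rwa [Fin.snoc_castSucc, Fin.succ_castSucc, Fin.snoc_castSucc]
  have h0' : Fin.snoc (α := fun _ => C) v c 0 = c₀ := by
    rw [← Fin.castSucc_zero, Fin.snoc_castSucc, h0]
  have := h (k + 1) _ (isMinimalGallery_iff.2 ⟨hg', by
    rw [h0', Fin.snoc_last, hd.galleryDist_eq, hk]⟩) h0' (Fin.snoc_last _ _) i.castSucc hi
  rwa [Fin.snoc_castSucc] at this

/-- A type-preserving automorphism that fixes the ball fixes all flexible chambers: a flexible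
chamber outside the ball lies on two panels of different types that contain flexible chambers closer
to `c₀`. -/
theorem apply_eq_of_forall_mem_ball {g : C → C}
    (hg : ∀ s c d, Δ.adj s c d → Δ.adj s (g c) (g d)) (hfix : ∀ b ∈ Δ.ball c₀ n, g b = b)
    (h : Δ.IsFlexible c₀ n c) : g c = c := by
  revert h
  refine precedes_induction (Δ := Δ) (x := c₀) (p := fun c => Δ.IsFlexible c₀ n c → g c = c)
    (fun _ => hfix _ ((galleryDist_eq_zero_iff.2 rfl).le.trans (Nat.zero_le n))) ?_ c
  intro c ih s d hd hc
  by_cases hcn : Δ.galleryDist c₀ c ≤ n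
  · exact hfix c hcn
  have hex : ∃ t, t ≠ s ∧ cs.IsRightDescent (Δ.weylDist c₀ c) t := by
    by_contra! hall
    exact hc.not_isFirm (Nat.not_le.1 hcn) ⟨s, hd.isRightDescent, fun u hu =>
      by_contra fun hus => hall u hus hu⟩
  obtain ⟨t, hts, ht⟩ := hex
  obtain ⟨d', hd'⟩ := Δ.exists_precedes ht
  have key : ∀ u e, Δ.Precedes c₀ u e c → g c ∈ Δ.panel u c := by
    intro u e he
    have h1 := hg u e c he.1
    rw [ih e he.galleryDist_lt (hc.of_precedes he)] at h1
    rw [panel_eq_of_mem he.mem_panel]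
    exact mem_panel_of_adj h1
  exact eq_of_mem_panel_of_mem_panel (Γ := Δ.toChamberSystem) hts (key t d' hd') (key s d hd)

section RightAngled

variable (hM : M.IsRightAngled)
include hM

/-- A reduced word leading to a flexible chamber contains no letter `s` more than `n` times:
otherwise deleting right descents other than `s` leads to a firm chamber outside the ball. -/
theorem count_le [DecidableEq S] (h : Δ.IsFlexible c₀ n c) {ω : List S} (hω : cs.IsReduced ω)
    (hc : Δ.weylDist c₀ c = cs.wordProd ω) (s : S) : ω.count s ≤ n := by
  induction hl : ω.length generalizing ω c with
  | zero => simp [List.length_eq_zero_iff.1 hl]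
  | succ l ih =>
    by_contra! hn
    have hlen : Δ.galleryDist c₀ c = ω.length := by rw [galleryDist, hc, hω.eq]
    have hfirm := h.not_isFirm (hn.trans_le (hlen ▸ List.count_le_length))
    have hex : ∃ t, t ≠ s ∧ cs.IsRightDescent (Δ.weylDist c₀ c) t := by
      by_contra! hall
      obtain ⟨t, ht⟩ := cs.exists_rightDescent_of_ne_one (w := Δ.weylDist c₀ c) (by
        rw [Ne, ← cs.length_eq_zero_iff, hc, hω.eq]
        lia)
      exact hfirm ⟨t, ht, fun u hu => by
        rw [by_contra fun h => hall u h hu, by_contra fun h => hall t h ht]⟩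
    obtain ⟨t, hts, ht⟩ := hex
    obtain ⟨d, hd⟩ := Δ.exists_precedes ht
    rw [hc] at ht
    obtain ⟨α, β, rfl, -, h1, h2⟩ := cs.exists_eq_append_cons_forall_eq_two hM hω ht
    have h3 := ih (h.of_precedes hd) h2 (by rw [hd.weylDist_eq', hc, h1])
      (by simp only [List.length_append, List.length_cons] at hl ⊢; lia)
    rw [List.count_append, List.count_cons_of_ne hts] at hn
    rw [List.count_append] at h3
    lia

theorem galleryDist_le [Finite S] (h : Δ.IsFlexible c₀ n c) :
    Δ.galleryDist c₀ c ≤ Nat.card S * n := by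
  classical
  have := Fintype.ofFinite S
  obtain ⟨ω, hω, hc⟩ := cs.exists_isReduced (Δ.weylDist c₀ c)
  rw [galleryDist, hc, hω.eq, Nat.card_eq_fintype_card, Fintype.card, ← smul_eq_mul,
    ← Finset.sum_const]
  have h1 : ∑ s, Multiset.count s (ω : Multiset S) = ω.length :=
    Multiset.sum_count_eq_card fun s _ => Finset.mem_univ s
  rw [← h1]
  refine Finset.sum_le_sum fun s _ => ?_
  rw [Multiset.coe_count]
  exact h.count_le hM hω hc s

end RightAngled

end IsFlexible

theorem exists_isFirm_of_not_isFlexible {c₀ c : C} {n : ℕ} (h : ¬ Δ.IsFlexible c₀ n c) :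
    ∃ a, n < Δ.galleryDist c₀ a ∧ Δ.IsFirm c₀ a ∧
      ∃ r d, Δ.Precedes c₀ r d a ∧ c ∈ Δ.wing r a := by
  simp only [IsFlexible, not_or, not_forall, not_not] at h
  obtain ⟨-, k, v, hv, rfl, rfl, i, hi, hf⟩ := h
  have hi0 : Δ.galleryDist (v 0) (v i) = i := by
    simpa using galleryDist_eq_of_isMinimalGallery hv (Fin.zero_le i)
  refine ⟨v i, hi0.symm ▸ hi, hf, ?_⟩
  obtain ⟨j, rfl⟩ : ∃ j : Fin k, i = j.succ :=
    Fin.exists_succ_eq.2 (by rintro rfl; exact Nat.not_lt_zero _ hi) |>.imp fun _ h => h.symm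
  obtain ⟨r, hr⟩ := hv.1 j
  have hj0 := galleryDist_eq_of_isMinimalGallery hv (Fin.zero_le j.castSucc)
  have h1 := galleryDist_eq_of_isMinimalGallery hv (Fin.le_last j.castSucc)
  have h2 := galleryDist_eq_of_isMinimalGallery hv (Fin.le_last j.succ)
  simp only [Fin.val_zero, Fin.val_succ, Fin.val_last, Fin.val_castSucc] at hi0 hj0 h1 h2
  have hjk := j.isLt
  have hp : Δ.Precedes (v 0) r (v j.castSucc) (v j.succ) := by
    refine ⟨hr, fun h => ?_⟩
    rcases weylDist_eq_or_of_adj (x := v 0) hr with h3 | h3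
    · simp only [galleryDist] at hi0 hj0
      rw [h3] at hi0
      lia
    · rw [CoxeterSystem.IsRightDescent, ← h3] at h
      simp only [galleryDist] at hi0 hj0
      lia
  refine ⟨r, _, hp, ?_⟩
  rw [mem_wing_iff]
  intro h
  rw [galleryDist_comm] at h1 h2
  simp only [galleryDist] at h1 h2
  rcases weylDist_eq_or_of_adj (x := v (Fin.last k)) (Δ.symm hr) with h3 | h3
  · rw [h3] at h1
    lia
  · rw [CoxeterSystem.IsRightDescent, ← h3] at h
    lia

end Building

/-! ### Chambers fixed by the stabilizer of a ball -/

open Building ChamberSystem in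
theorem mainTheorem4 {S W C : Type*} [Finite S] [Group W] {M : CoxeterMatrix S}
    (hM : M.IsRightAngled) (cs : CoxeterSystem M W) (Δ : Building cs C)
    (hthick : Δ.IsThick) (hreg : Δ.IsSemiRegular) (c₀ : C) (n : ℕ) :
    MulAction.fixedPoints (fixingSubgroup Δ.aut (Δ.ball c₀ n)) C = Δ.flex c₀ n ∧
      Δ.IsBoundedSet (Δ.flex c₀ n) := by
  refine ⟨Set.Subset.antisymm (fun c hc => ?_) (fun c hc g => ?_), ?_⟩
  · by_contra hflex
    obtain ⟨a, han, hfirm, r, d, hd, hca⟩ := exists_isFirm_of_not_isFlexible hflex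
    -- Thickness provides a third chamber `e` in the panel of `a` and `d`.
    obtain ⟨e, he, hed, hea⟩ : ∃ e ∈ Δ.panel r d, e ≠ d ∧ e ≠ a := by
      by_contra! h
      have h1 : Δ.panel r d ⊆ {d, a} := fun e he => or_iff_not_imp_left.2 (h e he)
      have h2 := (hthick r d).trans (Set.encard_le_encard h1)
      rw [Set.encard_pair (ne_of_adj hd.1)] at h2
      exact absurd h2 (by decide)
    have hae : Δ.adj r a e := adj_of_mem_panel hd.mem_panel he (Ne.symm hea)
    have hde : Δ.adj r d e := adj_of_mem_panel (self_mem_panel r d) he (Ne.symm hed)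
    obtain ⟨g, hg, hgfix, hgmove⟩ := exists_mem_aut_exchanging_wings hM hreg hae
    have hgK : (⟨g, hg⟩ : Δ.aut) ∈ fixingSubgroup Δ.aut (Δ.ball c₀ n) := by
      rw [mem_fixingSubgroup_iff]
      intro b hb
      have hbd : b ∈ Δ.wing r d := mem_wing_of_isFirm hM hfirm hd (lt_of_le_of_lt hb han)
      exact hgfix b (notMem_wing_of_adj hd.1 hbd) (notMem_wing_of_adj hde hbd)
    have hgc : g c = c := hc ⟨_, hgK⟩
    have h1 := hgmove c hca
    rw [hgc] at h1
    exact notMem_wing_of_adj hae hca h1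
  · have hK := (mem_fixingSubgroup_iff Δ.aut).1 g.2
    exact IsFlexible.apply_eq_of_forall_mem_ball
      (fun s c d h => (g.1.2 s c d).2 h) (fun b hb => hK b hb) hc
  · refine ⟨Nat.card S * n + Nat.card S * n, fun c hc d hd => ?_⟩
    refine (galleryDist_triangle c c₀ d).trans (Nat.add_le_add ?_ ?_)
    · rw [galleryDist_comm]
      exact IsFlexible.galleryDist_le hM hc
    · exact IsFlexible.galleryDist_le hM hd
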